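/- Let $\mathsf{Rng}$ be the category of (associative, not necessarily unitary) rings, $\mathsf{CRng}$ its full subcategory of commutative rings, and $\mathsf{RedCRng}$ the full subcategory of $\mathsf{CRng}$ of reduced rings (those with $x^n=0,\ n\ge 1\Rightarrow x=0$). Let $I\colon\mathsf{Rng}\to\mathsf{CRng}$ and $F\colon\mathsf{CRng}\to\mathsf{RedCRng}$ be the reflectors (left adjoints of the inclusions). Consider the composite reflection $F\circ I\colon \mathsf{Rng}\to\mathsf{RedCRng}$, with unit $\eta$, together with the class of regular epimorphisms of $\mathsf{Rng}$. Terminology. A monadic extension is a regular epimorphism $p\colon E\to B$ such that pulling back along $p$ defines a monadic functor from regular epimorphisms over $B$ to regular epimorphisms over $E$. A regular epimorphism $f\colon A\to B$ is a trivial extension if its naturality square for $\eta$ is a pullback; a monadic extension $f$ is a normal extension if the first projection of its kernel pair is a trivial extension. A normal extension $p\colon E\to B$ is weakly universal if for every normal extension $p'\colon E'\to B$ there is $u\colon E\to E'$ with $p=p'u$. Its Galois group is the kernel of $\langle FI(\pi_1),FI(\pi_2)\rangle\colon FI(E\times_BE)\to FI(E)\times FI(E)$, where $\pi_1,\pi_2$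 are the projections of the kernel pair of $p$; when $p$ is weakly universal, it is called the fundamental group $\pi_1(B)$. For a reflective subcategory $\mathcal X$ of $\mathsf{Rng}$ or of $\mathsf{CRng}$, the homological closure $\overline{J}^{\mathcal X}_A$ of an ideal $J$ of $A$ is the inverse image along $A\to A/J$ of the kernel of the unit of the reflection at $A/J$. For $f\colon A\to B$ in $\mathsf{Rng}$ with kernel $K$ and kernel pair $(\pi_1,\pi_2)\colon R\rightrightarrows A$, the relative commutator $[K,A]_{\mathsf{CRng}}$ is the image under $\pi_2$ of the set of elements of $R$ that are killed both by $\pi_1$ and by the unit $R\to I(R)$. All ideals of non-commutative rings are two-sided. Then: (1) The Galois structure given by $F\circ I$ and the regular epimorphisms is admissible: for every $B$ in $\mathsf{Rng}$ and every surjective $\varphi\colon X\to FI(B)$ with $X$ in $\mathsf{RedCRng}$, the second projection $B\times_{FI(B)}X\to X$ induces an isomorphism $FI(B\times_{FI(B)}X)\cong X$. The functor $F$ is protoadditive, i.e. it preserves split short exact sequences. (2) For every ideal $J$ of a commutative ring $A$, the homological closure of $J$ for the reflection $F\colon\mathsf{CRng}\to\mathsf{RedCRng}$ is its radical: $\overline{J}^{\mathsf{RedCRng}}_A=\sqrt{J}_{(A)}=\{a\in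 A\mid a^n\in J\text{ for some }n\ge1\}$. (3) Let $0\to K\to P\xrightarrow{f} B\to 0$ be a free presentation of a ring $B$, i.e. $P$ is a free ring, $f$ is a regular epimorphism and $K$ is its kernel. Then $[P,P]_{\mathsf{CRng}}$ (the relative commutator of $P\to 0$) is the ideal of $P$ generated by the elements $pp'-p'p$ with $p,p'\in P$, and $[K,P]_{\mathsf{CRng}}$ (that of $f$) is the ideal of $P$ generated by the elements $pk-kp$ with $k\in K$, $p\in P$. Their closures for the reflection $\mathsf{Rng}\to\mathsf{RedCRng}$, the first in $P$ and the second in $K$, are the radicals $$\sqrt{[P,P]_{\mathsf{CRng}}}_{(P)}=\{p\in P\mid p^n\in[P,P]_{\mathsf{CRng}}\text{ for some }n\ge1\},\qquad \sqrt{[K,P]_{\mathsf{CRng}}}_{(K)}=\{k\in K\mid k^n\in[K,P]_{\mathsf{CRng}}\text{ for some }n\ge1\},$$ which are ideals of $P$ and of $K$ respectively, and the second is contained in the first. Weakly universal normal extensions of $B$ exist, and for each of them the Galois group is isomorphic, as a ring, to the quotient below; that is, $$\pi_1(B)\cong\frac{K\wedge\sqrt{[P,P]_{\mathsf{CRng}}}_{(P)}}{\sqrt{[K,P]_{\mathsf{CRng}}}_{(K)}}.$$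 -/

import Mathlib

open CategoryTheory CategoryTheory.Limits

universe v₁ v₂ u₁ u₂ u

/-! ### Galois structures -/

/-- A Galois structure: a (full) reflective subcategory `H : ℬ ⥤ 𝒜` together with a class `ℰ` of
morphisms of `𝒜`, preserved by the reflection, along which pullbacks exist, which is closed under
composition, contains the isomorphisms and is stable under pullback. -/
structure GaloisStructure (𝒜 : Type u₁) (ℬ : Type u₂) [Category.{v₁} 𝒜] [Category.{v₂} ℬ] where
  /-- the inclusion functor -/
  H : ℬ ⥤ 𝒜
  /-- full faithfulness of the inclusion, the left adjoint `I` and the adjunction -/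
  reflective : Reflective H
  /-- the class of extensions -/
  ℰ : MorphismProperty 𝒜
  map_mem : ∀ {X Y : 𝒜} (f : X ⟶ Y), ℰ f → ℰ (H.map ((reflector H).map f))
  hasPullback : ∀ {X Y Z : 𝒜} (f : X ⟶ Z) (g : Y ⟶ Z), ℰ f → HasPullback f g
  comp_mem : ℰ.IsStableUnderComposition
  iso_mem : ∀ {X Y : 𝒜} (f : X ⟶ Y), IsIso f → ℰ f
  pullback_mem : ℰ.IsStableUnderBaseChange

namespace GaloisStructure

attribute [instance] GaloisStructure.reflective GaloisStructure.comp_mem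
  GaloisStructure.pullback_mem

variable {𝒜 : Type u₁} {ℬ : Type u₂} [Category.{v₁} 𝒜] [Category.{v₂} ℬ]
  (Γ : GaloisStructure 𝒜 ℬ)

instance {X Y : 𝒜} (p : X ⟶ Y) : Γ.ℰ.HasPullbacksAlong p where
  hasPullback g hg := Γ.hasPullback g p hg

/-- The reflector. -/
abbrev I : 𝒜 ⥤ ℬ := reflector Γ.H

/-- The component of the unit of the reflection at `A`. -/
abbrev η (A : 𝒜) : A ⟶ Γ.H.obj (Γ.I.obj A) := (reflectorAdjunction Γ.H).unit.app A

/-- Admissibility: for every `B` in `𝒜` and every `(X, φ)` in `ℬ ↓ I B`, the component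
`I (B ×_{HI B} H X) ⟶ I (H X) ⟶ X` of the counit of the adjunction `I^B ⊣ H^B` is an
isomorphism. -/
def Admissible : Prop :=
  ∀ (B : 𝒜) (X : ℬ) (φ : X ⟶ Γ.I.obj B), Γ.ℰ (Γ.H.map φ) →
    ∀ (Q : 𝒜) (π₁ : Q ⟶ B) (π₂ : Q ⟶ Γ.H.obj X), IsPullback π₁ π₂ (Γ.η B) (Γ.H.map φ) →
      IsIso (Γ.I.map π₂ ≫ (reflectorAdjunction Γ.H).counit.app X)

/-- Monadic extensions: arrows `p : E ⟶ B` in `ℰ` for which the pullback functor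
`p^* : 𝒜 ↓ B ⥤ 𝒜 ↓ E` between the categories of extensions (full subcategories of the slice
categories) is monadic. -/
def IsMonadicExtension {E B : 𝒜} (p : E ⟶ B) : Prop :=
  Γ.ℰ p ∧ Nonempty (MonadicRightAdjoint (MorphismProperty.Over.pullback Γ.ℰ ⊤ p))

/-- Trivial extensions: arrows in `ℰ` whose naturality square for the unit is a pullback. -/
def IsTrivialExtension {E B : 𝒜} (f : E ⟶ B) : Prop :=
  Γ.ℰ f ∧ IsPullback (Γ.η E) f (Γ.H.map (Γ.I.map f)) (Γ.η B)

/-- Normal extensions: monadic extensions `f` such that `f^* f`, the first projection of the kernel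
pair of `f` (which exists because `f` is in `ℰ`), is a trivial extension. -/
def IsNormalExtension {E B : 𝒜} (f : E ⟶ B) : Prop :=
  Γ.IsMonadicExtension f ∧
    ∀ (R : 𝒜) (π₁ π₂ : R ⟶ E), IsPullback π₁ π₂ f f → Γ.IsTrivialExtension π₁

/-- Weakly universal normal extensions of `B`: every normal extension of `B` receives a morphism
over `B` from it. -/
def IsWeaklyUniversalNormalExtension {E B : 𝒜} (p : E ⟶ B) : Prop :=
  Γ.IsNormalExtension p ∧
    ∀ (E' : 𝒜) (p' : E' ⟶ B), Γ.IsNormalExtension p' → ∃ w : E ⟶ E', p = w ≫ p'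

/-- The (underlying object of the) Galois group `Gal (E, p, 0)`: the pullback of
`⟨I π₁, I π₂⟩ : I (E ×_B E) ⟶ I E × I E` along `0 ⟶ I E × I E`. -/
noncomputable def galoisGroup [HasPullbacks 𝒜] [HasPullbacks ℬ] [HasBinaryProducts ℬ]
    [HasZeroObject ℬ] {E B : 𝒜} (p : E ⟶ B) : ℬ :=
  pullback
    (prod.lift (Γ.I.map (pullback.fst p p)) (Γ.I.map (pullback.snd p p)))
    ((isZero_zero ℬ).to_ (Γ.I.obj E ⨯ Γ.I.obj E))

end GaloisStructure

/-- Split short exact sequences `K ⟶ A ⇄ B` in a pointed category: `s` is a section of `f`,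
`k` is the kernel of `f` and `f` is the cokernel of `k`. -/
structure IsSplitShortExact {𝒞 : Type u₁} [Category.{v₁} 𝒞] [HasZeroObject 𝒞] {K A B : 𝒞}
    (k : K ⟶ A) (f : A ⟶ B) (s : B ⟶ A) : Prop where
  section_comp : s ≫ f = 𝟙 B
  isKernel : IsPullback k ((isZero_zero 𝒞).from_ K) f ((isZero_zero 𝒞).to_ B)
  isCokernel : IsPushout k ((isZero_zero 𝒞).from_ K) f ((isZero_zero 𝒞).to_ B)

/-- Protoadditive functors: those that preserve split short exact sequences. -/
def Protoadditive {𝒞 : Type u₁} {𝒟 : Type u₂} [Category.{v₁} 𝒞] [Category.{v₂} 𝒟]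
    [HasZeroObject 𝒞] [HasZeroObject 𝒟] (F : 𝒞 ⥤ 𝒟) : Prop :=
  ∀ ⦃K A B : 𝒞⦄ (k : K ⟶ A) (f : A ⟶ B) (s : B ⟶ A),
    IsSplitShortExact k f s → IsSplitShortExact (F.map k) (F.map f) (F.map s)

/-! ### Powers, quotients and radicals in rings without unit -/

section NonUnital

variable {A : Type u₁} {B : Type u₂} [NonUnitalRing A] [NonUnitalRing B]

/-- `ppow x n` is the power `x ^ (n + 1)`; these are all powers of `x` with positive exponent. -/
def ppow (x : A) : ℕ → A
  | 0 => x
  | n + 1 => ppow x n * x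

theorem map_ppow (f : A →ₙ+* B) (x : A) (n : ℕ) : f (ppow x n) = ppow (f x) n := by
  induction n with
  | zero => rfl
  | succ n ih => simp [ppow, ih]

theorem ppow_eq_npow {C : Type u₁} [Ring C] (x : C) (n : ℕ) : ppow x n = x ^ (n + 1) := by
  induction n with
  | zero => simp [ppow]
  | succ n ih => rw [ppow, ih, pow_succ x (n + 1)]

namespace TwoSidedIdeal

/-- The quotient `A / J`. -/
abbrev Quo (J : TwoSidedIdeal A) : Type u₁ := J.ringCon.Quotient

/-- The canonical projection `A → A / J`. -/
def quotMk (J : TwoSidedIdeal A) : A →ₙ+* J.Quo where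
  toFun a := (a : J.ringCon.Quotient)
  map_zero' := rfl
  map_add' _ _ := rfl
  map_mul' _ _ := rfl

theorem quotMk_surjective (J : TwoSidedIdeal A) : Function.Surjective J.quotMk :=
  Quotient.mk''_surjective

theorem quotMk_eq_zero (J : TwoSidedIdeal A) (a : A) : J.quotMk a = 0 ↔ a ∈ J := by
  rw [TwoSidedIdeal.mem_iff]
  exact RingCon.eq J.ringCon

/-- The homomorphism `A / J → B` induced by a homomorphism `A → B` that vanishes on `J`. -/
def quotLift (J : TwoSidedIdeal A) (f : A →ₙ+* B) (h : ∀ a ∈ J, f a = 0) : J.Quo →ₙ+* B where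
  toFun := Quotient.lift f fun a b hab => by
    have := h _ ((J.rel_iff a b).1 hab)
    rwa [map_sub, sub_eq_zero] at this
  map_zero' := map_zero f
  map_add' x y := by
    induction x using Quotient.inductionOn
    induction y using Quotient.inductionOn
    exact map_add f _ _
  map_mul' x y := by
    induction x using Quotient.inductionOn
    induction y using Quotient.inductionOn
    exact map_mul f _ _

@[simp]
theorem quotLift_quotMk (J : TwoSidedIdeal A) (f : A →ₙ+* B) (h : ∀ a ∈ J, f a = 0) (a : A) :
    J.quotLift f h (J.quotMk a) = f a := rfl

theorem quot_hom_ext (J : TwoSidedIdeal A) {f g : J.Quo →ₙ+* B}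
    (h : ∀ a, f (J.quotMk a) = g (J.quotMk a)) : f = g := by
  ext x
  obtain ⟨a, rfl⟩ := J.quotMk_surjective x
  exact h a

theorem quot_comm (J : TwoSidedIdeal A) (hJ : ∀ x y : A, x * y - y * x ∈ J) (x y : J.Quo) :
    x * y = y * x := by
  obtain ⟨a, rfl⟩ := J.quotMk_surjective x
  obtain ⟨b, rfl⟩ := J.quotMk_surjective y
  rw [← sub_eq_zero, ← map_mul, ← map_mul, ← map_sub, quotMk_eq_zero]
  exact hJ a b

theorem exists_commRing_hom (J : TwoSidedIdeal A) (hJ : ∀ x y : A, x * y - y * x ∈ J) :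
    ∃ (R : Type u₁) (_ : CommRing R) (g : A →ₙ+* R), ∀ a, g a = 0 ↔ a ∈ J := by
  let _ : NonUnitalCommRing J.Quo := { mul_comm := J.quot_comm hJ }
  refine ⟨Unitization ℤ J.Quo, inferInstance,
    (Unitization.inrNonUnitalAlgHom ℤ J.Quo : J.Quo →ₙ+* Unitization ℤ J.Quo).comp J.quotMk,
    fun a => ?_⟩
  rw [← quotMk_eq_zero]
  exact ⟨fun h => Unitization.inr_injective (R := ℤ) h, fun h => congrArg Unitization.inr h⟩

theorem exists_ppow_mem_iff {J : TwoSidedIdeal A} {R : Type u₂} [CommRing R] {g : A →ₙ+* R}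
    (hg : ∀ a, g a = 0 ↔ a ∈ J) (a : A) : (∃ n, ppow a n ∈ J) ↔ IsNilpotent (g a) := by
  constructor
  · rintro ⟨n, hn⟩
    exact ⟨n + 1, by rw [← ppow_eq_npow, ← map_ppow]; exact (hg _).2 hn⟩
  · rintro ⟨n, hn⟩
    exact ⟨n, (hg _).1 (by rw [map_ppow, ppow_eq_npow, pow_succ, hn, zero_mul])⟩

/-- The radical `√J = {a | ∃ n ≥ 1, a ^ n ∈ J}` of a two-sided ideal `J` containing all
commutators (every ideal is such if the ring is commutative). -/
def radical (J : TwoSidedIdeal A) (hJ : ∀ x y : A, x * y - y * x ∈ J) : TwoSidedIdeal A :=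
  TwoSidedIdeal.mk' {a | ∃ n, ppow a n ∈ J}
    ⟨0, J.zero_mem⟩
    (fun {x y} hx hy => by
      obtain ⟨R, _, g, hg⟩ := exists_commRing_hom J hJ
      have key := exists_ppow_mem_iff hg
      refine (key (x + y)).2 ?_
      rw [map_add]
      exact (Commute.all _ _).isNilpotent_add ((key x).1 hx) ((key y).1 hy))
    (fun {x} hx => by
      obtain ⟨R, _, g, hg⟩ := exists_commRing_hom J hJ
      have key := exists_ppow_mem_iff hg
      refine (key (-x)).2 ?_
      rw [map_neg]
      exact ((key x).1 hx).neg)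
    (fun {x y} hy => by
      obtain ⟨R, _, g, hg⟩ := exists_commRing_hom J hJ
      have key := exists_ppow_mem_iff hg
      refine (key (x * y)).2 ?_
      rw [map_mul]
      exact (Commute.all _ _).isNilpotent_mul_left ((key y).1 hy))
    (fun {x y} hx => by
      obtain ⟨R, _, g, hg⟩ := exists_commRing_hom J hJ
      have key := exists_ppow_mem_iff hg
      refine (key (x * y)).2 ?_
      rw [map_mul]
      exact (Commute.all _ _).isNilpotent_mul_right ((key x).1 hx))

theorem mem_radical (J : TwoSidedIdeal A) (hJ : ∀ x y : A, x * y - y * x ∈ J) (a : A) :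
    a ∈ J.radical hJ ↔ ∃ n, ppow a n ∈ J :=
  TwoSidedIdeal.mem_mk' _ _ _ _ _ _ _

/-- `[A, A]`, the two-sided ideal of `A` generated by the elements `x y - y x`. -/
def commutatorIdeal (A : Type u₁) [NonUnitalRing A] : TwoSidedIdeal A :=
  TwoSidedIdeal.span {z | ∃ x y : A, z = x * y - y * x}

theorem commutator_mem (x y : A) : x * y - y * x ∈ commutatorIdeal A :=
  TwoSidedIdeal.subset_span ⟨x, y, rfl⟩

/-- `[K, A]`, the two-sided ideal of `A` generated by the elements `a k - k a` with `k ∈ K` and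
`a ∈ A`. -/
def commutatorWith (K : TwoSidedIdeal A) : TwoSidedIdeal A :=
  TwoSidedIdeal.span {z | ∃ k ∈ K, ∃ a : A, z = a * k - k * a}

/-- The two-sided ideal `K` regarded as a ring, with its inclusion into `A`. -/
def incl (K : TwoSidedIdeal A) : K →ₙ+* A := NonUnitalSubringClass.subtype K

/-- `[K, A]` regarded as an ideal of `K` (it is contained in `K`). -/
def commutatorIn (K : TwoSidedIdeal A) : TwoSidedIdeal K :=
  TwoSidedIdeal.comap K.incl K.commutatorWith

theorem commutatorIn_mem (K : TwoSidedIdeal A) (x y : K) : x * y - y * x ∈ K.commutatorIn :=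
  (TwoSidedIdeal.mem_comap K.incl).2 (TwoSidedIdeal.subset_span ⟨y, y.2, x, rfl⟩)

/-- The inclusion of an ideal into a larger one. -/
def inclOfLE {I J : TwoSidedIdeal A} (h : I ≤ J) : I →ₙ+* J where
  toFun x := ⟨x, h x.2⟩
  map_zero' := rfl
  map_add' _ _ := rfl
  map_mul' _ _ := rfl

end TwoSidedIdeal

end NonUnital

/-! ### The category of rings without unit -/

/-- The category `Rng` of (not necessarily unitary, associative) rings. -/
structure Rng where
  of ::
  /-- the underlying type -/
  carrier : Type u
  [ring : NonUnitalRing carrier]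

namespace Rng

attribute [instance] Rng.ring

instance : CoeSort Rng.{u} (Type u) := ⟨Rng.carrier⟩

/-- Morphisms of `Rng`: additive and multiplicative maps. -/
@[ext]
structure Hom (A B : Rng.{u}) where
  hom' : A →ₙ+* B

instance : Category Rng.{u} where
  Hom A B := Hom A B
  id A := ⟨NonUnitalRingHom.id A⟩
  comp f g := ⟨g.hom'.comp f.hom'⟩

instance : ConcreteCategory.{u} Rng.{u} (fun A B => A →ₙ+* B) where
  hom := Hom.hom'
  ofHom f := ⟨f⟩

/-- The ring homomorphism underlying a morphism of `Rng`. -/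
abbrev Hom.hom {A B : Rng.{u}} (f : Hom A B) : A →ₙ+* B := ConcreteCategory.hom (C := Rng) f

/-- The morphism of `Rng` given by a ring homomorphism. -/
abbrev ofHom {A B : Type u} [NonUnitalRing A] [NonUnitalRing B] (f : A →ₙ+* B) : of A ⟶ of B :=
  ConcreteCategory.ofHom (C := Rng) f

@[ext]
theorem hom_ext {A B : Rng.{u}} {f g : A ⟶ B} (h : f.hom = g.hom) : f = g := Hom.ext h

theorem elem_ext {A B : Rng.{u}} {f g : A ⟶ B} (h : ∀ a : A, f.hom a = g.hom a) : f = g :=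
  hom_ext (NonUnitalRingHom.ext h)

theorem congr_elem {A B : Rng.{u}} {f g : A ⟶ B} (h : f = g) (a : A) : f.hom a = g.hom a := by
  rw [h]

theorem isZero_of_subsingleton (A : Rng.{u}) [Subsingleton A] : IsZero A where
  unique_to B := ⟨⟨⟨⟨0⟩⟩, fun f => elem_ext fun a => by
    rw [Subsingleton.elim a 0, map_zero, map_zero]⟩⟩
  unique_from B := ⟨⟨⟨⟨0⟩⟩, fun _ => elem_ext fun _ => Subsingleton.elim _ _⟩⟩

instance : HasZeroObject Rng.{u} := ⟨of PUnit, isZero_of_subsingleton (of PUnit)⟩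

section Pullback

variable {A B C : Rng.{u}} (f : A ⟶ C) (g : B ⟶ C)

/-- The fibre product of two homomorphisms. -/
def fibreProduct : NonUnitalSubring (A × B) where
  carrier := {x | f.hom x.1 = g.hom x.2}
  zero_mem' := by simp
  add_mem' := by
    intro x y hx hy
    simp only [Set.mem_ofPred_eq] at hx hy
    simp [hx, hy]
  neg_mem' := by
    intro x hx
    simp only [Set.mem_ofPred_eq] at hx
    simp [hx]
  mul_mem' := by
    intro x y hx hy
    simp only [Set.mem_ofPred_eq] at hx hy
    simp [hx, hy]

/-- The first projection of the fibre product. -/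
def fibreFst : of (fibreProduct f g) ⟶ A :=
  ofHom ((NonUnitalRingHom.fst A B).comp (NonUnitalSubringClass.subtype (fibreProduct f g)))

/-- The second projection of the fibre product. -/
def fibreSnd : of (fibreProduct f g) ⟶ B :=
  ofHom ((NonUnitalRingHom.snd A B).comp (NonUnitalSubringClass.subtype (fibreProduct f g)))

theorem isPullback_fibreProduct : IsPullback (fibreFst f g) (fibreSnd f g) f g where
  w := elem_ext fun x => x.2
  isLimit' := ⟨PullbackCone.IsLimit.mk _
    (fun s => ofHom (B := fibreProduct f g)
      { toFun := fun x => ⟨(s.fst.hom x, s.snd.hom x), congr_elem s.condition x⟩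
        map_zero' := Subtype.ext (Prod.ext (map_zero _) (map_zero _))
        map_add' := fun x y => Subtype.ext (Prod.ext (map_add _ x y) (map_add _ x y))
        map_mul' := fun x y => Subtype.ext (Prod.ext (map_mul _ x y) (map_mul _ x y)) })
    (fun _ => rfl) (fun _ => rfl)
    (fun _ _ h₁ h₂ => elem_ext fun x =>
      Subtype.ext (Prod.ext (congr_elem h₁ x) (congr_elem h₂ x)))⟩

end Pullback

instance : HasPullbacks Rng.{u} :=
  haveI : ∀ {A B C : Rng.{u}} {f : A ⟶ C} {g : B ⟶ C}, HasLimit (cospan f g) :=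
    fun {_ _ _ f g} => (isPullback_fibreProduct f g).hasPullback
  hasPullbacks_of_hasLimit_cospan _

instance : HasFiniteLimits Rng.{u} :=
  haveI : HasTerminal Rng.{u} := HasZeroObject.hasTerminal
  hasFiniteLimits_of_hasTerminal_and_pullbacks

/-- The regular epimorphisms of `Rng` are the surjective homomorphisms. -/
theorem isRegularEpi_iff_surjective {A B : Rng.{u}} (f : A ⟶ B) :
    IsRegularEpi f ↔ Function.Surjective f.hom := by
  constructor
  · rintro ⟨⟨r⟩⟩
    let S := NonUnitalRingHom.range f.hom
    let e : A ⟶ of S := ofHom f.hom.rangeRestrict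
    let i : of S ⟶ B := ofHom (NonUnitalSubringClass.subtype S)
    have hei : e ≫ i = f := rfl
    have hw : r.left ≫ e = r.right ≫ e :=
      elem_ext fun x => Subtype.ext (congr_elem r.w x)
    let d : B ⟶ of S := r.isColimit.desc (Cofork.ofπ e hw)
    have hd : f ≫ d = e := r.isColimit.fac (Cofork.ofπ e hw) WalkingParallelPair.one
    have hid : d ≫ i = 𝟙 B := by
      refine Cofork.IsColimit.hom_ext r.isColimit ?_
      change f ≫ d ≫ i = f ≫ 𝟙 B
      rw [← Category.assoc, hd, hei, Category.comp_id]
    intro b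
    obtain ⟨a, ha⟩ := (d.hom b).2
    exact ⟨a, ha.trans (congr_elem hid b)⟩
  · intro hf
    refine ⟨⟨⟨_, fibreFst f f, fibreSnd f f, (isPullback_fibreProduct f f).w, ?_⟩⟩⟩
    have key : ∀ (s : Cofork (fibreFst f f) (fibreSnd f f)) (a a' : A),
        f.hom a = f.hom a' → s.π.hom a = s.π.hom a' := fun s a a' h =>
      congr_elem s.condition (⟨(a, a'), h⟩ : fibreProduct f f)
    have hinv := Function.surjInv_eq hf
    let d : ∀ s : Cofork (fibreFst f f) (fibreSnd f f), B ⟶ s.pt := fun s =>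
      ⟨{ toFun := fun b => s.π.hom (Function.surjInv hf b)
         map_zero' := (key s _ _ (by rw [hinv, map_zero])).trans (map_zero s.π.hom)
         map_add' := fun x y =>
          (key s _ _ (by simp only [map_add, hinv])).trans (map_add s.π.hom _ _)
         map_mul' := fun x y =>
          (key s _ _ (by simp only [map_mul, hinv])).trans (map_mul s.π.hom _ _) }⟩
    refine Cofork.IsColimit.mk _ d (fun s => ?_) (fun s m hm => ?_)
    · exact elem_ext fun a => key s _ _ (hinv _)
    · refine elem_ext fun b => ?_
      have h := congr_elem hm (Function.surjInv hf b)
      exact (congrArg m.hom (hinv b)).symm.trans h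

instance : (MorphismProperty.regularEpi Rng.{u}).IsStableUnderComposition where
  comp_mem f g hf hg := by
    rw [MorphismProperty.regularEpi_iff, isRegularEpi_iff_surjective] at *
    exact hg.comp hf

instance : (MorphismProperty.regularEpi Rng.{u}).IsStableUnderBaseChange where
  of_isPullback {X Y Y' S f g f' g'} h hg := by
    rw [MorphismProperty.regularEpi_iff, isRegularEpi_iff_surjective] at *
    intro y
    obtain ⟨x, hx⟩ := hg (f.hom y)
    let z : fibreProduct g f := ⟨(x, y), hx⟩
    have hw := (isPullback_fibreProduct g f).w
    exact ⟨(h.lift _ _ hw).hom z, congr_elem (h.lift_snd _ _ hw) z⟩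

end Rng

/-! ### Commutative rings and reduced commutative rings -/

/-- Commutativity, as a property of objects of `Rng`. -/
def Rng.isComm : ObjectProperty Rng.{u} := fun A => ∀ x y : A, x * y = y * x

/-- The full subcategory `CRng` of `Rng` of (not necessarily unitary) commutative rings. -/
abbrev CRng := Rng.isComm.{u}.FullSubcategory

/-- Reducedness: `x ^ n = 0` with `n ≥ 1` implies `x = 0`. -/
def CRng.isReduced : ObjectProperty CRng.{u} :=
  fun A => ∀ (x : A.obj) (n : ℕ), ppow x n = 0 → x = 0

/-- The full subcategory `RedCRng` of `CRng` of reduced commutative rings. -/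
abbrev RedCRng := CRng.isReduced.{u}.FullSubcategory

namespace CRng

/-- The inclusion `H : CRng ⥤ Rng`. -/
abbrev inclusion : CRng.{u} ⥤ Rng.{u} := Rng.isComm.ι

/-- The reflection of a ring in `CRng`: its quotient by the ideal generated by commutators. -/
def reflObj (A : Rng.{u}) : CRng.{u} :=
  ⟨Rng.of (TwoSidedIdeal.commutatorIdeal A).Quo,
    TwoSidedIdeal.quot_comm _ TwoSidedIdeal.commutator_mem⟩

/-- The universal property of the reflection in `CRng`. -/
def reflEquiv (A : Rng.{u}) (C : CRng.{u}) : (reflObj A ⟶ C) ≃ (A ⟶ inclusion.obj C) where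
  toFun g := ⟨g.hom.hom.comp (TwoSidedIdeal.quotMk _)⟩
  invFun f := ObjectProperty.homMk ⟨TwoSidedIdeal.quotLift _ f.hom fun a ha => by
    refine (TwoSidedIdeal.mem_ker (f := f.hom)).1
      ((TwoSidedIdeal.span_le (I := TwoSidedIdeal.ker f.hom)).2 ?_ ha)
    rintro _ ⟨x, y, rfl⟩
    rw [SetLike.mem_coe, TwoSidedIdeal.mem_ker, map_sub, map_mul, map_mul, sub_eq_zero]
    exact C.property _ _⟩
  left_inv g := by
    apply ObjectProperty.hom_ext
    exact Rng.hom_ext (TwoSidedIdeal.quot_hom_ext _ fun a => rfl)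
  right_inv f := rfl

/-- `I : Rng ⥤ CRng`, left adjoint to the inclusion `H`. -/
instance : Reflective inclusion.{u} where
  L := Adjunction.leftAdjointOfEquiv reflEquiv (fun _ _ _ _ _ => rfl)
  adj := Adjunction.adjunctionOfEquivLeft reflEquiv (fun _ _ _ _ _ => rfl)

instance : HasFiniteLimits CRng.{u} where
  out _ _ _ := hasLimitsOfShape_of_reflective inclusion

theorem isZero_of_subsingleton (A : CRng.{u}) [Subsingleton A.obj] : IsZero A where
  unique_to B := ⟨⟨⟨ObjectProperty.homMk ((Rng.isZero_of_subsingleton A.obj).to_ B.obj)⟩, fun _ =>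
    ObjectProperty.hom_ext _ ((Rng.isZero_of_subsingleton A.obj).eq_of_src _ _)⟩⟩
  unique_from B := ⟨⟨⟨ObjectProperty.homMk ((Rng.isZero_of_subsingleton A.obj).from_ B.obj)⟩,
    fun _ => ObjectProperty.hom_ext _ ((Rng.isZero_of_subsingleton A.obj).eq_of_tgt _ _)⟩⟩

instance : HasZeroObject CRng.{u} :=
  ⟨⟨Rng.of PUnit, fun _ _ => rfl⟩, @isZero_of_subsingleton _ (inferInstanceAs (Subsingleton PUnit))⟩

theorem commutator_mem (A : CRng.{u}) (J : TwoSidedIdeal A.obj) (x y : A.obj) :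
    x * y - y * x ∈ J := by
  rw [A.property x y, sub_self]
  exact J.zero_mem

/-- The quotient of a commutative ring by an ideal. -/
def quotient (A : CRng.{u}) (J : TwoSidedIdeal A.obj) : CRng.{u} :=
  ⟨Rng.of J.Quo, J.quot_comm (A.commutator_mem J)⟩

end CRng

namespace RedCRng

/-- The inclusion `U : RedCRng ⥤ CRng`. -/
abbrev inclusion : RedCRng.{u} ⥤ CRng.{u} := CRng.isReduced.ι

theorem ppow_ppow {A : Type u} [NonUnitalRing A] (x : A) (m n : ℕ) :
    ppow (ppow x m) n = ppow x ((m + 1) * (n + 1) - 1) := by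
  have h : ∀ i j, ppow x i * ppow x j = ppow x (i + j + 1) := by
    intro i j
    induction j with
    | zero => rfl
    | succ j ih => rw [ppow, ← mul_assoc, ih]; rfl
  induction n with
  | zero => simp [ppow]
  | succ n ih =>
    rw [ppow, ih, h]
    congr 1
    have : (m + 1) * (n + 1) ≥ 1 := Nat.mul_pos (by omega) (by omega)
    rw [show (m + 1) * (n + 1 + 1) = (m + 1) * (n + 1) + (m + 1) by ring]
    omega

/-- The ideal of nilpotent elements of a commutative ring. -/
def nilradical (A : CRng.{u}) : TwoSidedIdeal A.obj :=
  TwoSidedIdeal.radical ⊥ (A.commutator_mem ⊥)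

theorem mem_nilradical (A : CRng.{u}) (x : A.obj) : x ∈ nilradical A ↔ ∃ n, ppow x n = 0 :=
  TwoSidedIdeal.mem_radical _ _ _

/-- The reflection of a commutative ring in `RedCRng`: its quotient by the ideal of nilpotent
elements. -/
def reflObj (A : CRng.{u}) : RedCRng.{u} :=
  ⟨A.quotient (nilradical A), fun x n hx => by
    change (nilradical A).Quo at x
    obtain ⟨a, rfl⟩ := (nilradical A).quotMk_surjective x
    obtain ⟨m, hm⟩ := (mem_nilradical A _).1 (((nilradical A).quotMk_eq_zero _).1
      ((map_ppow (nilradical A).quotMk a n).trans hx))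
    rw [ppow_ppow] at hm
    exact ((nilradical A).quotMk_eq_zero _).2 ((mem_nilradical A _).2 ⟨_, hm⟩)⟩

/-- The universal property of the reflection in `RedCRng`. -/
def reflEquiv (A : CRng.{u}) (C : RedCRng.{u}) : (reflObj A ⟶ C) ≃ (A ⟶ inclusion.obj C) where
  toFun g := ObjectProperty.homMk ⟨g.hom.hom.hom.comp (nilradical A).quotMk⟩
  invFun f := ObjectProperty.homMk (ObjectProperty.homMk
    ⟨(nilradical A).quotLift f.hom.hom fun a ha => by
      obtain ⟨n, hn⟩ := (mem_nilradical A a).1 ha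
      refine C.property _ n ?_
      refine (map_ppow f.hom.hom a n).symm.trans ?_
      rw [hn, map_zero]⟩)
  left_inv g := by
    apply ObjectProperty.hom_ext
    apply ObjectProperty.hom_ext
    exact Rng.hom_ext (TwoSidedIdeal.quot_hom_ext _ fun a => rfl)
  right_inv f := rfl

/-- `F : CRng ⥤ RedCRng`, left adjoint to the inclusion `U`. -/
instance : Reflective inclusion.{u} where
  L := Adjunction.leftAdjointOfEquiv reflEquiv (fun _ _ _ _ _ => rfl)
  adj := Adjunction.adjunctionOfEquivLeft reflEquiv (fun _ _ _ _ _ => rfl)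

instance : HasFiniteLimits RedCRng.{u} where
  out _ _ _ := hasLimitsOfShape_of_reflective inclusion

instance : HasZeroObject RedCRng.{u} :=
  ⟨⟨⟨Rng.of PUnit, fun _ _ => rfl⟩, fun _ _ _ => rfl⟩, by
    have h : IsZero (⟨Rng.of PUnit, fun _ _ => rfl⟩ : CRng.{u}) :=
      @CRng.isZero_of_subsingleton _ (inferInstanceAs (Subsingleton PUnit))
    exact
    { unique_to := fun B => ⟨⟨⟨ObjectProperty.homMk (h.to_ B.obj)⟩, fun f =>
        ObjectProperty.hom_ext _ (h.eq_of_src _ _)⟩⟩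
      unique_from := fun B => ⟨⟨⟨ObjectProperty.homMk (h.from_ B.obj)⟩, fun f =>
        ObjectProperty.hom_ext _ (h.eq_of_tgt _ _)⟩⟩ }⟩

/-- The composite inclusion `H ∘ U : RedCRng ⥤ Rng`. Its reflector is `F ∘ I`, by composition of
the two adjunctions. -/
abbrev toRng : RedCRng.{u} ⥤ Rng.{u} := inclusion ⋙ CRng.inclusion

theorem unit_surjective (A : Rng.{u}) :
    Function.Surjective ((reflectorAdjunction toRng.{u}).unit.app A).hom := by
  intro x
  obtain ⟨y, rfl⟩ := TwoSidedIdeal.quotMk_surjective _ x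
  obtain ⟨z, rfl⟩ := TwoSidedIdeal.quotMk_surjective _ y
  exact ⟨z, rfl⟩

/-- The Galois structure of the composite reflection `Rng ⥤ CRng ⥤ RedCRng`, with `ℰ` the class of
all regular epimorphisms of `Rng`. -/
def galoisStructure : GaloisStructure Rng.{u} RedCRng.{u} where
  H := toRng
  reflective := inferInstance
  ℰ := MorphismProperty.regularEpi Rng
  map_mem {X Y} f hf := by
    rw [MorphismProperty.regularEpi_iff, Rng.isRegularEpi_iff_surjective] at *
    intro y
    obtain ⟨z, rfl⟩ := unit_surjective Y y
    obtain ⟨x, rfl⟩ := hf z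
    exact ⟨((reflectorAdjunction toRng).unit.app X).hom x,
      (Rng.congr_elem ((reflectorAdjunction toRng).unit.naturality f) x).symm⟩
  hasPullback _ _ _ := inferInstance
  comp_mem := inferInstance
  iso_mem f _ := isRegularEpi_of_regularEpi (RegularEpi.ofIso (asIso f))
  pullback_mem := inferInstance

end RedCRng

/-! ### Closures, relative commutators and free rings -/

/-- The homological closure in `A` of a normal subobject (two-sided ideal) `J`, with respect to a
reflective subcategory of `Rng`: the inverse image along `A ⟶ A / J` of the kernel of the unit of
the reflection at `A / J`. -/
def Rng.closure {ℬ : Type u₂} [Category.{v₂} ℬ] (H : ℬ ⥤ Rng.{u}) [Reflective H] {A : Type u}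
    [NonUnitalRing A] (J : TwoSidedIdeal A) : TwoSidedIdeal A :=
  TwoSidedIdeal.comap J.quotMk
    (TwoSidedIdeal.ker ((reflectorAdjunction H).unit.app (Rng.of J.Quo)).hom)

/-- The homological closure in `A` of an ideal `J`, with respect to a reflective subcategory of
`CRng`. -/
def CRng.closure {ℬ : Type u₂} [Category.{v₂} ℬ] (U : ℬ ⥤ CRng.{u}) [Reflective U] (A : CRng.{u})
    (J : TwoSidedIdeal A.obj) : TwoSidedIdeal A.obj :=
  TwoSidedIdeal.comap J.quotMk
    (TwoSidedIdeal.ker ((reflectorAdjunction U).unit.app (A.quotient J)).hom.hom)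

/-- The relative commutator `[K[f], A]_ℬ` for `f : A ⟶ B`, as a subset of `A`: let `N` be the
kernel of the unit of the reflection in `ℬ` at the kernel pair `R[f]`; the relative commutator is
the kernel of the restriction of the first projection to `N`, embedded in `A` by the second
projection. -/
def Rng.relativeCommutator {ℬ : Type u₂} [Category.{v₂} ℬ] (H : ℬ ⥤ Rng.{u}) [Reflective H]
    {A B : Rng.{u}} (f : A ⟶ B) : Set A :=
  {a | ∃ r : (pullback f f : Rng.{u}), ((reflectorAdjunction H).unit.app (pullback f f)).hom r = 0 ∧
    (pullback.fst f f).hom r = 0 ∧ (pullback.snd f f).hom r = a}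

/-- `P` is a free ring: it has a basis `ι : X → P` such that every map from `X` to a ring extends
uniquely to a homomorphism on `P`. -/
def Rng.IsFree (P : Rng.{u}) : Prop :=
  ∃ (X : Type u) (ι : X → P), ∀ (C : Rng.{u}) (g : X → C), ∃! φ : P ⟶ C, ∀ x, φ.hom (ι x) = g x

namespace Rng

variable {P B : Rng.{u}} (f : P ⟶ B)

/-- The kernel `K` of `f : P ⟶ B`, as an ideal of `P`. -/
abbrev kernelIdeal : TwoSidedIdeal P := TwoSidedIdeal.ker f.hom

/-- The radical `√[P, P]` in `P`. -/
def radicalCommutator (P : Rng.{u}) : TwoSidedIdeal P :=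
  (TwoSidedIdeal.commutatorIdeal P).radical TwoSidedIdeal.commutator_mem

/-- The radical `√[K, P]` in `K`. -/
def kernelRadicalCommutator : TwoSidedIdeal (kernelIdeal f) :=
  (kernelIdeal f).commutatorIn.radical (kernelIdeal f).commutatorIn_mem

/-- The intersection `K ∧ √[P, P]`. -/
def hopfNumerator : TwoSidedIdeal P := kernelIdeal f ⊓ radicalCommutator P

/-- The inclusion of `K ∧ √[P, P]` in `K`. -/
def hopfInclusion : hopfNumerator f →ₙ+* kernelIdeal f :=
  TwoSidedIdeal.inclOfLE inf_le_left

/-- `√[K, P]` regarded as an ideal of `K ∧ √[P, P]` (in which it is contained). -/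
def hopfDenominator : TwoSidedIdeal (hopfNumerator f) :=
  TwoSidedIdeal.comap (hopfInclusion f) (kernelRadicalCommutator f)

/-- The quotient ring `(K ∧ √[P, P]) / √[K, P]`. -/
def hopfQuotient : Rng.{u} := Rng.of (hopfDenominator f).Quo

end Rng

/-!
Write `√[K, A]` for the ideal of those `k ∈ K` having a power in `[K, A]`. If two homomorphisms
`φ, ψ : R → A` agree modulo `K`, then `φ z - ψ z ∈ √[K, A]` for all `z ∈ √[R, R]`. Applied to the
kernel pair `R` of a surjection `p : E → B` with kernel `K`, this identifies the elements `(0, k)`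
of the kernel of the unit `R → FI(R)` with the elements `k` of `√[K, E]`. Hence `p` is a normal
extension if and only if `√[K, E] = 0`, and the Galois group of a normal extension is
`K ∧ √[E, E]`.

For a projective presentation `P → B` with kernel `K`, the extension `P / √[K, P] → B` is normal,
and it is weakly universal by projectivity of `P`; its Galois group is the Hopf quotient. Two
endomorphisms over `B` of a normal extension `E` agree on `√[E, E]`, so the Galois group does not
depend on the choice of a weakly universal normal extension.
-/

/-! ### Relative commutators and their radicals -/

namespace Rng

section RelativeRadical

open TwoSidedIdeal (commutatorIdeal commutator_mem commutatorWith)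

variable {A : Type u₁} {B : Type u₂} [NonUnitalRing A] [NonUnitalRing B]

/-- The unital ring obtained from `A / J` by adjoining an identity. It reduces questions about
powers modulo `J` to the theory of nilpotent elements of unital rings. -/
def UnitizedQuotient (J : TwoSidedIdeal A) : Type u₁ := Unitization ℤ J.Quo

instance (J : TwoSidedIdeal A) : Ring (UnitizedQuotient J) :=
  inferInstanceAs (Ring (Unitization ℤ J.Quo))

/-- The canonical map `A → A / J → UnitizedQuotient J`. -/
def toUnitization (J : TwoSidedIdeal A) : A →ₙ+* UnitizedQuotient J :=
  (Unitization.inrNonUnitalAlgHom ℤ J.Quo : J.Quo →ₙ+* Unitization ℤ J.Quo).comp J.quotMk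

theorem toUnitization_eq_zero {J : TwoSidedIdeal A} {a : A} : toUnitization J a = 0 ↔ a ∈ J := by
  rw [← J.quotMk_eq_zero]
  exact ⟨fun h => Unitization.inr_injective (R := ℤ) h, fun h => congrArg Unitization.inr h⟩

theorem isNilpotent_toUnitization {J : TwoSidedIdeal A} {a : A} :
    IsNilpotent (toUnitization J a) ↔ ∃ n, ppow a n ∈ J := by
  constructor
  · rintro ⟨n, hn⟩
    exact ⟨n, toUnitization_eq_zero.1 (by rw [map_ppow, ppow_eq_npow, pow_succ, hn, zero_mul])⟩
  · rintro ⟨n, hn⟩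
    exact ⟨n + 1, by rw [← ppow_eq_npow, ← map_ppow, toUnitization_eq_zero.2 hn]⟩

theorem commute_toUnitization {J : TwoSidedIdeal A} {a b : A} (h : a * b - b * a ∈ J) :
    Commute (toUnitization J a) (toUnitization J b) :=
  sub_eq_zero.1 (by rw [← map_mul, ← map_mul, ← map_sub, toUnitization_eq_zero.2 h])

theorem ppow_mem {J : TwoSidedIdeal A} {a : A} (ha : a ∈ J) : ∀ n, ppow a n ∈ J
  | 0 => ha
  | _ + 1 => J.mul_mem_left _ _ ha

theorem zero_ppow (n : ℕ) : ppow (0 : A) n = 0 :=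
  (TwoSidedIdeal.mem_bot A).1 (ppow_mem (TwoSidedIdeal.zero_mem ⊥) n)

theorem mem_map_of_surjective {g : A →ₙ+* B} (hg : Function.Surjective g) {J : TwoSidedIdeal A}
    {b : B} : b ∈ J.map g ↔ ∃ a ∈ J, g a = b := by
  refine ⟨fun hb => ?_, ?_⟩
  · induction hb using TwoSidedIdeal.span_induction with
    | mem _ hx => exact hx
    | zero => exact ⟨0, J.zero_mem, map_zero g⟩
    | add x y _ _ hx hy =>
      obtain ⟨⟨a, ha, rfl⟩, b, hb, rfl⟩ := hx, hy
      exact ⟨a + b, J.add_mem ha hb, map_add g a b⟩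
    | neg x _ hx =>
      obtain ⟨a, ha, rfl⟩ := hx
      exact ⟨-a, J.neg_mem ha, map_neg g a⟩
    | left_absorb x y _ hy =>
      obtain ⟨⟨a, rfl⟩, b, hb, rfl⟩ := hg x, hy
      exact ⟨a * b, J.mul_mem_left a b hb, map_mul g a b⟩
    | right_absorb x y _ hy =>
      obtain ⟨⟨a, rfl⟩, b, hb, rfl⟩ := hg x, hy
      exact ⟨b * a, J.mul_mem_right b a hb, map_mul g b a⟩
  · rintro ⟨a, ha, rfl⟩
    exact TwoSidedIdeal.subset_span ⟨a, ha, rfl⟩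

variable {K : TwoSidedIdeal A} {K' : TwoSidedIdeal B}

theorem commutator_mem_commutatorWith {k : A} (hk : k ∈ K) (a : A) :
    a * k - k * a ∈ K.commutatorWith :=
  TwoSidedIdeal.subset_span ⟨k, hk, a, rfl⟩

theorem commutator_mem_commutatorWith' {k : A} (hk : k ∈ K) (a : A) :
    k * a - a * k ∈ K.commutatorWith := by
  rw [← neg_sub]
  exact K.commutatorWith.neg_mem (commutator_mem_commutatorWith hk a)

theorem commutatorWith_le : K.commutatorWith ≤ K := by
  refine TwoSidedIdeal.span_le.2 ?_
  rintro _ ⟨k, hk, a, rfl⟩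
  exact K.sub_mem (K.mul_mem_left a k hk) (K.mul_mem_right k a hk)

theorem map_mem_commutatorWith (g : A →ₙ+* B) (hK : K ≤ K'.comap g) {a : A}
    (ha : a ∈ K.commutatorWith) : g a ∈ K'.commutatorWith := by
  have h : K.commutatorWith ≤ K'.commutatorWith.comap g := by
    refine TwoSidedIdeal.span_le.2 ?_
    rintro _ ⟨k, hk, x, rfl⟩
    rw [SetLike.mem_coe, TwoSidedIdeal.mem_comap, map_sub, map_mul, map_mul]
    exact commutator_mem_commutatorWith ((TwoSidedIdeal.mem_comap g).1 (hK hk)) (g x)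
  exact (TwoSidedIdeal.mem_comap g).1 (h ha)

theorem exists_mem_commutatorWith_comap {g : A →ₙ+* B} (hg : Function.Surjective g) {b : B}
    (hb : b ∈ K'.commutatorWith) : ∃ a ∈ (K'.comap g).commutatorWith, g a = b := by
  have h : K'.commutatorWith ≤ (K'.comap g).commutatorWith.map g := by
    refine TwoSidedIdeal.span_le.2 ?_
    rintro _ ⟨k, hk, x, rfl⟩
    obtain ⟨⟨k, rfl⟩, x, rfl⟩ := hg k, hg x
    exact (mem_map_of_surjective hg).2
      ⟨x * k - k * x, commutator_mem_commutatorWith ((TwoSidedIdeal.mem_comap g).2 hk) x,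
        by rw [map_sub, map_mul, map_mul]⟩
  exact (mem_map_of_surjective hg).1 (h hb)

theorem commutatorWith_top : (⊤ : TwoSidedIdeal A).commutatorWith = commutatorIdeal A := by
  refine le_antisymm (TwoSidedIdeal.span_le.2 ?_) (TwoSidedIdeal.span_le.2 ?_)
  · rintro _ ⟨k, -, a, rfl⟩
    exact commutator_mem a k
  · rintro _ ⟨x, y, rfl⟩
    exact commutator_mem_commutatorWith (TwoSidedIdeal.mem_top A) x

theorem commutatorWith_eq_bot (h : ∀ k ∈ K, ∀ a, a * k = k * a) : K.commutatorWith = ⊥ := by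
  refine le_antisymm (TwoSidedIdeal.span_le.2 ?_) bot_le
  rintro _ ⟨k, hk, a, rfl⟩
  rw [SetLike.mem_coe, TwoSidedIdeal.mem_bot, h k hk a, sub_self]

theorem map_mem_commutatorIdeal (g : A →ₙ+* B) {a : A} (ha : a ∈ commutatorIdeal A) :
    g a ∈ commutatorIdeal B := by
  rw [← commutatorWith_top] at ha ⊢
  exact map_mem_commutatorWith g le_top ha

theorem mul_mem_commutatorWith {k z : A} (hk : k ∈ K) (hz : z ∈ commutatorIdeal A) :
    k * z ∈ K.commutatorWith := by
  induction hz using TwoSidedIdeal.span_induction generalizing k with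
  | mem z hz =>
    obtain ⟨x, y, rfl⟩ := hz
    have h : k * (x * y - y * x) = (k * x * y - y * (k * x)) + (y * k - k * y) * x := by
      noncomm_ring
    rw [h]
    exact K.commutatorWith.add_mem
      (commutator_mem_commutatorWith' (K.mul_mem_right k x hk) y)
      (K.commutatorWith.mul_mem_right _ x (commutator_mem_commutatorWith hk y))
  | zero => rw [mul_zero]; exact K.commutatorWith.zero_mem
  | add y z _ _ hy hz => rw [mul_add]; exact K.commutatorWith.add_mem (hy hk) (hz hk)
  | neg z _ hz => rw [mul_neg]; exact K.commutatorWith.neg_mem (hz hk)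
  | left_absorb a z _ hz => rw [← mul_assoc]; exact hz (K.mul_mem_right k a hk)
  | right_absorb a z _ hz => rw [← mul_assoc]; exact K.commutatorWith.mul_mem_right _ a (hz hk)

theorem mul_mem_commutatorWith' {k z : A} (hk : k ∈ K) (hz : z ∈ commutatorIdeal A) :
    z * k ∈ K.commutatorWith := by
  rw [← sub_add_cancel (z * k) (k * z)]
  exact K.commutatorWith.add_mem (commutator_mem_commutatorWith hk z) (mul_mem_commutatorWith hk hz)

theorem map_sub_map_mem_commutatorWith {φ ψ : B →ₙ+* A} (h : ∀ b, φ b - ψ b ∈ K) {z : B}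
    (hz : z ∈ commutatorIdeal B) : φ z - ψ z ∈ K.commutatorWith := by
  induction hz using TwoSidedIdeal.span_induction with
  | mem z hz =>
    obtain ⟨x, y, rfl⟩ := hz
    have e : φ (x * y - y * x) - ψ (x * y - y * x) =
        ((φ x - ψ x) * φ y - φ y * (φ x - ψ x)) + (ψ x * (φ y - ψ y) - (φ y - ψ y) * ψ x) := by
      simp only [map_sub, map_mul]
      noncomm_ring
    rw [e]
    exact K.commutatorWith.add_mem (commutator_mem_commutatorWith' (h x) (φ y))
      (commutator_mem_commutatorWith (h y) (ψ x))
  | zero => rw [map_zero, map_zero, sub_zero]; exact K.commutatorWith.zero_mem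
  | add y z _ _ hy hz =>
    rw [map_add, map_add, add_sub_add_comm]
    exact K.commutatorWith.add_mem hy hz
  | neg z _ hz =>
    rw [map_neg, map_neg, neg_sub_neg, ← neg_sub]
    exact K.commutatorWith.neg_mem hz
  | left_absorb a z hz ih =>
    have e : φ (a * z) - ψ (a * z) = (φ a - ψ a) * φ z + ψ a * (φ z - ψ z) := by
      simp only [map_mul]
      noncomm_ring
    rw [e]
    exact K.commutatorWith.add_mem (mul_mem_commutatorWith (h a) (map_mem_commutatorIdeal φ hz))
      (K.commutatorWith.mul_mem_left _ _ ih)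
  | right_absorb a z hz ih =>
    have e : φ (z * a) - ψ (z * a) = (φ z - ψ z) * φ a + ψ z * (φ a - ψ a) := by
      simp only [map_mul]
      noncomm_ring
    rw [e]
    exact K.commutatorWith.add_mem (K.commutatorWith.mul_mem_right _ _ ih)
      (mul_mem_commutatorWith' (h a) (map_mem_commutatorIdeal ψ hz))

variable (K) in
/-- The radical `√[K, A]` in `K` of the relative commutator `[K, A]`, regarded as an ideal of `A`.
For `K = ⊤` it is `√[A, A]`. -/
def relativeRadical : TwoSidedIdeal A :=
  TwoSidedIdeal.mk' {a | a ∈ K ∧ IsNilpotent (toUnitization K.commutatorWith a)}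
    ⟨K.zero_mem, by rw [map_zero]; exact IsNilpotent.zero⟩
    (fun {x y} hx hy => ⟨K.add_mem hx.1 hy.1, by
      rw [map_add]
      exact (commute_toUnitization (commutator_mem_commutatorWith hy.1 x)).isNilpotent_add
        hx.2 hy.2⟩)
    (fun {x} hx => ⟨K.neg_mem hx.1, by rw [map_neg]; exact hx.2.neg⟩)
    (fun {x y} hy => ⟨K.mul_mem_left x y hy.1, by
      rw [map_mul]
      exact (commute_toUnitization (commutator_mem_commutatorWith hy.1 x)).isNilpotent_mul_left
        hy.2⟩)
    (fun {x y} hx => ⟨K.mul_mem_right x y hx.1, by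
      rw [map_mul]
      exact (commute_toUnitization (commutator_mem_commutatorWith' hx.1 y)).isNilpotent_mul_right
        hx.2⟩)

theorem mem_relativeRadical {a : A} :
    a ∈ relativeRadical K ↔ a ∈ K ∧ ∃ n, ppow a n ∈ K.commutatorWith := by
  rw [← isNilpotent_toUnitization]
  exact TwoSidedIdeal.mem_mk' _ _ _ _ _ _ _

theorem relativeRadical_le : relativeRadical K ≤ K := fun _ ha => (mem_relativeRadical.1 ha).1

theorem commutatorWith_le_relativeRadical : K.commutatorWith ≤ relativeRadical K := fun _ ha =>
  mem_relativeRadical.2 ⟨commutatorWith_le ha, 0, ha⟩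

theorem mem_relativeRadical_top {a : A} :
    a ∈ relativeRadical (⊤ : TwoSidedIdeal A) ↔ ∃ n, ppow a n ∈ commutatorIdeal A := by
  rw [mem_relativeRadical, commutatorWith_top]
  exact and_iff_right (TwoSidedIdeal.mem_top A)

theorem mem_relativeRadical_of_ppow_mem {a : A} (ha : a ∈ K) {n : ℕ}
    (h : ppow a n ∈ relativeRadical K) : a ∈ relativeRadical K := by
  obtain ⟨-, m, hm⟩ := mem_relativeRadical.1 h
  rw [RedCRng.ppow_ppow] at hm
  exact mem_relativeRadical.2 ⟨ha, _, hm⟩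

theorem map_mem_relativeRadical (g : A →ₙ+* B) (hK : K ≤ K'.comap g) {a : A}
    (ha : a ∈ relativeRadical K) : g a ∈ relativeRadical K' := by
  obtain ⟨haK, n, hn⟩ := mem_relativeRadical.1 ha
  refine mem_relativeRadical.2 ⟨(TwoSidedIdeal.mem_comap g).1 (hK haK), n, ?_⟩
  rw [← map_ppow]
  exact map_mem_commutatorWith g hK hn

theorem map_mem_relativeRadical_iff {g : A →ₙ+* B} (hg : Function.Surjective g)
    (hker : ∀ a, g a = 0 → a ∈ relativeRadical (K'.comap g)) {a : A} :
    g a ∈ relativeRadical K' ↔ a ∈ relativeRadical (K'.comap g) := by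
  refine ⟨fun h => ?_, map_mem_relativeRadical g le_rfl⟩
  obtain ⟨haK, n, hn⟩ := mem_relativeRadical.1 h
  obtain ⟨c, hc, hgc⟩ := exists_mem_commutatorWith_comap hg hn
  have hdiff : ppow a n - c ∈ relativeRadical (K'.comap g) :=
    hker _ (by rw [map_sub, map_ppow, hgc, sub_self])
  refine mem_relativeRadical_of_ppow_mem ((TwoSidedIdeal.mem_comap g).2 haK) (n := n) ?_
  rw [← sub_add_cancel (ppow a n) c]
  exact TwoSidedIdeal.add_mem _ hdiff (commutatorWith_le_relativeRadical hc)

theorem mul_mem_relativeRadical {k z : A} (hk : k ∈ K) (hz : z ∈ relativeRadical ⊤) :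
    k * z ∈ relativeRadical K := by
  obtain ⟨n, hn⟩ := mem_relativeRadical_top.1 hz
  refine mem_relativeRadical.2 ⟨K.mul_mem_right k z hk, n, toUnitization_eq_zero.1 ?_⟩
  have hcomm := commute_toUnitization (commutator_mem_commutatorWith' hk z)
  rw [map_ppow, map_mul, ppow_eq_npow, hcomm.mul_pow, ← ppow_eq_npow, ← ppow_eq_npow,
    ← map_ppow, ← map_ppow, ← map_mul, toUnitization_eq_zero]
  exact mul_mem_commutatorWith (ppow_mem hk n) hn

theorem map_sub_map_mem_relativeRadical {φ ψ : B →ₙ+* A} (h : ∀ b, φ b - ψ b ∈ K) {z : B}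
    (hz : z ∈ relativeRadical ⊤) : φ z - ψ z ∈ relativeRadical K := by
  have hmul (χ : B →ₙ+* A) : (φ z - ψ z) * χ z ∈ relativeRadical K :=
    mul_mem_relativeRadical (h z) (map_mem_relativeRadical χ le_top hz)
  -- `d = φ z - ψ z` satisfies `d ^ 2 = d * φ z - d * ψ z`, and both terms lie in `√[K, A]`.
  refine mem_relativeRadical_of_ppow_mem (h z) (n := 1) ?_
  change (φ z - ψ z) * (φ z - ψ z) ∈ relativeRadical K
  rw [mul_sub]
  exact TwoSidedIdeal.sub_mem _ (hmul φ) (hmul ψ)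

end RelativeRadical

end Rng

/-! ### Homomorphisms and pullbacks of rings, elementwise -/

namespace Rng

theorem isIso_of_bijective {A B : Rng.{u}} (f : A ⟶ B) (hf : Function.Bijective f.hom) :
    IsIso f := by
  let e : A ≃+* B := RingEquiv.ofBijective f.hom hf
  exact ⟨⟨⟨(e.symm : B →ₙ+* A)⟩, elem_ext e.symm_apply_apply, elem_ext e.apply_symm_apply⟩⟩

theorem bijective_of_isIso {A B : Rng.{u}} (f : A ⟶ B) [IsIso f] : Function.Bijective f.hom :=
  Function.bijective_iff_has_inverse.2
    ⟨(inv f).hom, congr_elem (IsIso.hom_inv_id f), congr_elem (IsIso.inv_hom_id f)⟩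

theorem nonempty_quo_iso {A B : Type u} [NonUnitalRing A] [NonUnitalRing B] {J : TwoSidedIdeal A}
    (g : A →ₙ+* B) (hg : Function.Surjective g) (hJ : ∀ a, g a = 0 ↔ a ∈ J) :
    Nonempty (of J.Quo ≅ of B) := by
  let d : of J.Quo ⟶ of B := ofHom (A := J.Quo) (J.quotLift g fun a ha => (hJ a).2 ha)
  have hd : Function.Bijective d.hom := by
    refine ⟨(injective_iff_map_eq_zero d.hom).2 fun x hx => ?_, fun b => ?_⟩
    · obtain ⟨a, rfl⟩ := J.quotMk_surjective x
      exact (J.quotMk_eq_zero a).2 ((hJ a).1 hx)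
    · obtain ⟨a, rfl⟩ := hg b
      exact ⟨J.quotMk a, rfl⟩
  have := isIso_of_bijective d hd
  exact ⟨asIso d⟩

theorem exists_desc {A B C : Rng.{u}} {c : A ⟶ B} (hc : Function.Surjective c.hom) (h : A ⟶ C)
    (hker : ∀ a, c.hom a = 0 → h.hom a = 0) : ∃ d : B ⟶ C, c ≫ d = h := by
  have key : ∀ a a', c.hom a = c.hom a' → h.hom a = h.hom a' := fun a a' haa' => by
    rw [← sub_eq_zero, ← map_sub] at haa' ⊢
    exact hker _ haa'
  have hinv := Function.surjInv_eq hc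
  refine ⟨⟨{ toFun := fun b => h.hom (Function.surjInv hc b)
             map_zero' := (key _ _ (by rw [hinv, map_zero])).trans (map_zero h.hom)
             map_add' := fun x y =>
               (key _ _ (by simp only [map_add, hinv])).trans (map_add h.hom _ _)
             map_mul' := fun x y =>
               (key _ _ (by simp only [map_mul, hinv])).trans (map_mul h.hom _ _) }⟩, ?_⟩
  exact elem_ext fun a => key _ _ (hinv _)

section IsPullback

variable {P A B C : Rng.{u}} {p : P ⟶ A} {q : P ⟶ B} {f : A ⟶ C} {g : B ⟶ C}

theorem exists_of_isPullback (h : IsPullback p q f g) {x : A} {y : B} (hxy : f.hom x = g.hom y) :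
    ∃ z, p.hom z = x ∧ q.hom z = y := by
  have hw := (isPullback_fibreProduct f g).w
  let z : fibreProduct f g := ⟨(x, y), hxy⟩
  exact ⟨(h.lift _ _ hw).hom z, congr_elem (h.lift_fst _ _ hw) z, congr_elem (h.lift_snd _ _ hw) z⟩

theorem ext_of_isPullback (h : IsPullback p q f g) {z z' : P} (h₁ : p.hom z = p.hom z')
    (h₂ : q.hom z = q.hom z') : z = z' := by
  have hF := isPullback_fibreProduct f g
  refine (bijective_of_isIso (h.isoIsPullback _ _ hF).hom).1 (Subtype.ext (Prod.ext ?_ ?_))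
  · have hfst := congr_elem (h.isoIsPullback_hom_fst _ _ hF)
    exact (hfst z).trans (h₁.trans (hfst z').symm)
  · have hsnd := congr_elem (h.isoIsPullback_hom_snd _ _ hF)
    exact (hsnd z).trans (h₂.trans (hsnd z').symm)

theorem isPullback_of_forall_exists (w : p ≫ f = q ≫ g)
    (hinj : ∀ z, p.hom z = 0 → q.hom z = 0 → z = 0)
    (hex : ∀ x y, f.hom x = g.hom y → ∃ z, p.hom z = x ∧ q.hom z = y) : IsPullback p q f g := by
  have hF := isPullback_fibreProduct f g
  let i : P ⟶ of (fibreProduct f g) := hF.lift p q w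
  have hfst : i ≫ fibreFst f g = p := hF.lift_fst p q w
  have hsnd : i ≫ fibreSnd f g = q := hF.lift_snd p q w
  have : IsIso i := by
    refine isIso_of_bijective i ⟨(injective_iff_map_eq_zero i.hom).2 fun z hz => ?_, fun z => ?_⟩
    · refine hinj z ?_ ?_
      · rw [← hfst]
        exact (congrArg (fibreFst f g).hom hz).trans (map_zero _)
      · rw [← hsnd]
        exact (congrArg (fibreSnd f g).hom hz).trans (map_zero _)
    · obtain ⟨y, h₁, h₂⟩ := hex _ _ z.2
      exact ⟨y, Subtype.ext (Prod.ext ((congr_elem hfst y).trans h₁)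
        ((congr_elem hsnd y).trans h₂))⟩
  exact IsPullback.of_iso hF (asIso i).symm (Iso.refl _) (Iso.refl _) (Iso.refl _)
    (by simp [← hfst]) (by simp [← hsnd]) (by simp) (by simp)

theorem isPullback_iff_exact [Subsingleton B] :
    IsPullback p q f g ↔ Function.Injective p.hom ∧ Function.Exact p.hom f.hom := by
  have hg (y : B) : g.hom y = 0 := by rw [Subsingleton.elim y 0, map_zero]
  constructor
  · refine fun h => ⟨fun z z' hz => ext_of_isPullback h hz (Subsingleton.elim _ _), fun a => ?_⟩
    refine ⟨fun ha => ?_, ?_⟩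
    · obtain ⟨z, hz, -⟩ := exists_of_isPullback h (ha.trans (hg 0).symm)
      exact ⟨z, hz⟩
    · rintro ⟨z, rfl⟩
      exact (congr_elem h.w z).trans (hg _)
  · rintro ⟨hinj, hex⟩
    refine isPullback_of_forall_exists (elem_ext fun z => ?_) (fun z hz _ => ?_) fun x y hxy => ?_
    · exact ((hex _).2 ⟨z, rfl⟩).trans (hg _).symm
    · exact hinj (hz.trans (map_zero p.hom).symm)
    · obtain ⟨z, hz⟩ := (hex x).1 (hxy.trans (hg y))
      exact ⟨z, hz, Subsingleton.elim _ _⟩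

end IsPullback

theorem subsingleton_of_isTerminal {A : Rng.{u}} (h : IsTerminal A) : Subsingleton A :=
  subsingleton_of_forall_eq 0 (congr_elem (h.hom_ext (𝟙 A) ⟨0⟩))

section RightAdjoint

variable {ℬ : Type u₂} [Category.{v₂} ℬ] (U : ℬ ⥤ Rng.{u}) [U.IsRightAdjoint]

theorem subsingleton_obj_of_isZero {Z : ℬ} (hZ : IsZero Z) : Subsingleton (U.obj Z) :=
  subsingleton_of_isTerminal (hZ.isTerminal.isTerminalObj U Z)

theorem map_prodLift_eq_zero_iff [HasTerminal ℬ] [HasBinaryProducts ℬ] {X Y Z : ℬ} (a : X ⟶ Y)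
    (b : X ⟶ Z) (x : U.obj X) :
    (U.map (prod.lift a b)).hom x = 0 ↔ (U.map a).hom x = 0 ∧ (U.map b).hom x = 0 := by
  have hprod := (IsPullback.of_hasBinaryProduct' Y Z).map U
  have hfst : (U.map prod.fst).hom ((U.map (prod.lift a b)).hom x) = (U.map a).hom x := by
    have h : U.map (prod.lift a b) ≫ U.map prod.fst = U.map a := by
      rw [← U.map_comp, prod.lift_fst]
    exact congr_elem h x
  have hsnd : (U.map prod.snd).hom ((U.map (prod.lift a b)).hom x) = (U.map b).hom x := by
    have h : U.map (prod.lift a b) ≫ U.map prod.snd = U.map b := by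
      rw [← U.map_comp, prod.lift_snd]
    exact congr_elem h x
  rw [← hfst, ← hsnd]
  refine ⟨fun h => by simp only [h, map_zero, and_self], fun h => ?_⟩
  exact ext_of_isPullback hprod (h.1.trans (map_zero _).symm) (h.2.trans (map_zero _).symm)

end RightAdjoint

end Rng

/-! ### Kernels of the units, closures and relative commutators -/

namespace Rng

section Hopf

variable {A B : Rng.{u}} {f : A ⟶ B}

theorem mem_kernelIdeal {a : A} : a ∈ kernelIdeal f ↔ f.hom a = 0 :=
  TwoSidedIdeal.mem_ker (f := f.hom)

theorem radicalCommutator_eq : A.radicalCommutator = relativeRadical ⊤ :=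
  TwoSidedIdeal.ext fun _ =>
    (TwoSidedIdeal.mem_radical _ _ _).trans mem_relativeRadical_top.symm

theorem mem_kernelRadicalCommutator {k : kernelIdeal f} :
    k ∈ kernelRadicalCommutator f ↔ (k : A) ∈ relativeRadical (kernelIdeal f) := by
  refine (TwoSidedIdeal.mem_radical _ _ _).trans (Iff.trans ?_ mem_relativeRadical.symm)
  refine (exists_congr fun n => ?_).trans (and_iff_right k.2).symm
  have hpow : (kernelIdeal f).incl (ppow k n) = ppow (k : A) n := map_ppow _ k n
  rw [← hpow]
  exact TwoSidedIdeal.mem_comap _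

theorem mem_hopfNumerator {a : A} :
    a ∈ hopfNumerator f ↔ f.hom a = 0 ∧ a ∈ relativeRadical (⊤ : TwoSidedIdeal A) := by
  rw [← radicalCommutator_eq, ← mem_kernelIdeal]
  exact TwoSidedIdeal.mem_inf _

theorem mem_hopfDenominator {a : hopfNumerator f} :
    a ∈ hopfDenominator f ↔ (a : A) ∈ relativeRadical (kernelIdeal f) :=
  (TwoSidedIdeal.mem_comap _).trans mem_kernelRadicalCommutator

theorem mem_hopfNumerator_of_mem_kernelRadicalCommutator {k : kernelIdeal f}
    (hk : k ∈ kernelRadicalCommutator f) : (k : A) ∈ hopfNumerator f :=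
  mem_hopfNumerator.2 ⟨mem_kernelIdeal.1 k.2,
    map_mem_relativeRadical (NonUnitalRingHom.id A) le_top (mem_kernelRadicalCommutator.1 hk)⟩

end Hopf

section KernelPair

variable {R A B : Rng.{u}} {f : A ⟶ B} {π₁ π₂ : R ⟶ A} (h : IsPullback π₁ π₂ f f)
include h

theorem sub_mem_kernelIdeal_of_isPullback (r : R) : π₂.hom r - π₁.hom r ∈ kernelIdeal f := by
  rw [mem_kernelIdeal, map_sub, sub_eq_zero]
  exact (congr_elem h.w r).symm

theorem exists_mem_commutatorIdeal_of_mem_commutatorWith {a : A}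
    (ha : a ∈ (kernelIdeal f).commutatorWith) :
    ∃ r ∈ TwoSidedIdeal.commutatorIdeal R, π₁.hom r = 0 ∧ π₂.hom r = a := by
  have hdiag (x : A) : ∃ r, π₁.hom r = x ∧ π₂.hom r = x := exists_of_isPullback h rfl
  induction ha using TwoSidedIdeal.span_induction with
  | mem a ha =>
    obtain ⟨k, hk, x, rfl⟩ := ha
    obtain ⟨r, -, hr₂⟩ := hdiag x
    obtain ⟨s, hs₁, hs₂⟩ := exists_of_isPullback h (x := 0) (y := k)
      ((map_zero _).trans (mem_kernelIdeal.1 hk).symm)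
    refine ⟨r * s - s * r, TwoSidedIdeal.commutator_mem r s, ?_, ?_⟩
    · rw [map_sub, map_mul, map_mul, hs₁, mul_zero, zero_mul, sub_zero]
    · rw [map_sub, map_mul, map_mul, hr₂, hs₂]
  | zero => exact ⟨0, TwoSidedIdeal.zero_mem _, map_zero _, map_zero _⟩
  | add a b _ _ iha ihb =>
    obtain ⟨⟨r, hr, hr₁, rfl⟩, s, hs, hs₁, rfl⟩ := iha, ihb
    exact ⟨r + s, TwoSidedIdeal.add_mem _ hr hs, by rw [map_add, hr₁, hs₁, add_zero], map_add _ _ _⟩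
  | neg a _ iha =>
    obtain ⟨r, hr, hr₁, rfl⟩ := iha
    exact ⟨-r, TwoSidedIdeal.neg_mem _ hr, by rw [map_neg, hr₁, neg_zero], map_neg _ _⟩
  | left_absorb x a _ iha =>
    obtain ⟨⟨d, -, rfl⟩, r, hr, hr₁, rfl⟩ := hdiag x, iha
    exact ⟨d * r, TwoSidedIdeal.mul_mem_left _ d r hr, by rw [map_mul, hr₁, mul_zero],
      map_mul _ _ _⟩
  | right_absorb x a _ iha =>
    obtain ⟨⟨d, -, rfl⟩, r, hr, hr₁, rfl⟩ := hdiag x, iha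
    exact ⟨r * d, TwoSidedIdeal.mul_mem_right _ r d hr, by rw [map_mul, hr₁, zero_mul],
      map_mul _ _ _⟩

theorem mem_relativeRadical_kernelPair_iff {r : R} (hr : π₁.hom r = 0) :
    r ∈ relativeRadical ⊤ ↔ π₂.hom r ∈ relativeRadical (kernelIdeal f) := by
  constructor
  · intro hrad
    rw [← sub_zero (π₂.hom r), ← hr]
    exact map_sub_map_mem_relativeRadical (sub_mem_kernelIdeal_of_isPullback h) hrad
  · intro hrad
    obtain ⟨-, n, hn⟩ := mem_relativeRadical.1 hrad
    obtain ⟨s, hs, hs₁, hs₂⟩ := exists_mem_commutatorIdeal_of_mem_commutatorWith h hn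
    have hrs : s = ppow r n := by
      refine ext_of_isPullback h ?_ (by rw [hs₂, map_ppow])
      rw [hs₁, map_ppow, hr, zero_ppow]
    exact mem_relativeRadical_top.2 ⟨n, hrs ▸ hs⟩

end KernelPair

theorem relativeCommutator_inclusion {A B : Rng.{u}} (f : A ⟶ B) :
    relativeCommutator CRng.inclusion.{u} f = ((kernelIdeal f).commutatorWith : Set A) := by
  have h := IsPullback.of_hasPullback f f
  ext a
  refine Iff.trans (exists_congr fun r => and_congr_left fun _ =>
    TwoSidedIdeal.quotMk_eq_zero _ r) ⟨?_, exists_mem_commutatorIdeal_of_mem_commutatorWith h⟩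
  rintro ⟨r, hr, hr₁, rfl⟩
  rw [← sub_zero ((pullback.snd f f).hom r), ← hr₁]
  exact map_sub_map_mem_commutatorWith (sub_mem_kernelIdeal_of_isPullback h) hr

theorem relativeCommutator_inclusion_from_zero (P : Rng.{u}) :
    relativeCommutator CRng.inclusion.{u} ((isZero_zero Rng.{u}).from_ P) =
      (TwoSidedIdeal.commutatorIdeal P : Set P) := by
  have htop : kernelIdeal ((isZero_zero Rng.{u}).from_ P) = ⊤ := by
    refine top_unique fun a _ => mem_kernelIdeal.2 ?_
    have h : (isZero_zero Rng.{u}).from_ P = ⟨0⟩ := (isZero_zero Rng.{u}).eq_of_tgt _ _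
    exact congr_elem h a
  rw [relativeCommutator_inclusion, htop, commutatorWith_top]

end Rng

namespace RedCRng

/-- The unit of the composite reflection `Rng ⥤ RedCRng`. -/
abbrev unit (A : Rng.{u}) : A ⟶ toRng.obj ((reflector toRng.{u}).obj A) :=
  (reflectorAdjunction toRng.{u}).unit.app A

/-- The unit of the reflection `CRng ⥤ RedCRng`, as a morphism of `Rng`. -/
abbrev reductionMap (A : CRng.{u}) : A.obj ⟶ toRng.obj ((reflector inclusion.{u}).obj A) :=
  ((reflectorAdjunction inclusion.{u}).unit.app A).hom

theorem unit_eq_zero_iff {A : Rng.{u}} {a : A} :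
    (unit A).hom a = 0 ↔ a ∈ Rng.relativeRadical ⊤ := by
  refine (TwoSidedIdeal.quotMk_eq_zero _ (TwoSidedIdeal.quotMk _ a)).trans ?_
  refine (mem_nilradical _ _).trans ?_
  rw [Rng.mem_relativeRadical_top]
  refine exists_congr fun n => ?_
  rw [← TwoSidedIdeal.quotMk_eq_zero, map_ppow]
  rfl

theorem map_unit {A B : Rng.{u}} (f : A ⟶ B) (a : A) :
    (toRng.map ((reflector toRng).map f)).hom ((unit A).hom a) = (unit B).hom (f.hom a) :=
  (Rng.congr_elem ((reflectorAdjunction toRng.{u}).unit.naturality f) a).symm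

theorem reductionMap_eq_zero_iff {A : CRng.{u}} {a : A.obj} :
    (reductionMap A).hom a = 0 ↔ ∃ n, ppow a n = 0 :=
  (TwoSidedIdeal.quotMk_eq_zero _ a).trans (mem_nilradical A a)

theorem reductionMap_surjective (A : CRng.{u}) : Function.Surjective (reductionMap A).hom :=
  TwoSidedIdeal.quotMk_surjective _

theorem map_reductionMap {A B : CRng.{u}} (f : A ⟶ B) (a : A.obj) :
    (toRng.map ((reflector inclusion).map f)).hom ((reductionMap A).hom a) =
      (reductionMap B).hom (f.hom.hom a) :=
  (Rng.congr_elem (congrArg (fun g => g.hom)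
    ((reflectorAdjunction inclusion.{u}).unit.naturality f)) a).symm

theorem closure_inclusion (A : CRng.{u}) (J : TwoSidedIdeal A.obj) :
    CRng.closure inclusion.{u} A J = J.radical (A.commutator_mem J) := by
  refine TwoSidedIdeal.ext fun a => ?_
  refine (reductionMap_eq_zero_iff (A := A.quotient J)).trans ?_
  rw [TwoSidedIdeal.mem_radical]
  refine exists_congr fun n => ?_
  rw [← TwoSidedIdeal.quotMk_eq_zero, map_ppow]
  rfl

theorem closure_toRng {A : Type u} [NonUnitalRing A] (J : TwoSidedIdeal A)
    (hJ : ∀ x y : A, x * y - y * x ∈ J) : Rng.closure toRng.{u} J = J.radical hJ := by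
  refine TwoSidedIdeal.ext fun a => ?_
  refine (unit_eq_zero_iff (A := Rng.of J.Quo)).trans ?_
  rw [TwoSidedIdeal.mem_radical, Rng.mem_relativeRadical, and_iff_right (TwoSidedIdeal.mem_top _),
    Rng.commutatorWith_eq_bot fun x _ y => J.quot_comm hJ y x]
  refine exists_congr fun n => ?_
  rw [TwoSidedIdeal.mem_bot, ← TwoSidedIdeal.quotMk_eq_zero, map_ppow]

end RedCRng

/-! ### Admissibility and protoadditivity -/

namespace Rng

theorem mem_relativeRadical_top_of_isPullback {Q A B C : Rng.{u}} {π₁ : Q ⟶ A} {π₂ : Q ⟶ B}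
    {f : A ⟶ C} {g : B ⟶ C} (h : IsPullback π₁ π₂ f g) (hπ : Function.Surjective π₁.hom)
    (hB : B.isComm) {q : Q} (h₁ : π₁.hom q ∈ relativeRadical ⊤) (h₂ : π₂.hom q = 0) :
    q ∈ relativeRadical ⊤ := by
  obtain ⟨n, hn⟩ := mem_relativeRadical_top.1 h₁
  rw [← commutatorWith_top] at hn
  obtain ⟨c, hc, hcn⟩ := exists_mem_commutatorWith_comap hπ hn
  have hc : c ∈ (⊤ : TwoSidedIdeal Q).commutatorWith :=
    map_mem_commutatorWith (NonUnitalRingHom.id Q) le_top hc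
  have hcB : π₂.hom c = 0 := by
    have h := map_mem_commutatorWith (K' := ⊤) π₂.hom le_top hc
    rwa [commutatorWith_eq_bot fun x _ y => hB y x, TwoSidedIdeal.mem_bot] at h
  have hcq : c = ppow q n :=
    ext_of_isPullback h (by rw [hcn, map_ppow]) (by rw [hcB, map_ppow, h₂, zero_ppow])
  exact mem_relativeRadical.2 ⟨TwoSidedIdeal.mem_top _, n, hcq ▸ hc⟩

end Rng

namespace RedCRng

theorem unit_map_counit {Q : Rng.{u}} {X : RedCRng.{u}} (g : Q ⟶ toRng.obj X) :
    unit Q ≫ toRng.map ((reflector toRng).map g ≫ (reflectorAdjunction toRng).counit.app X) = g :=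
  ((reflectorAdjunction toRng.{u}).homEquiv_unit _ _ _).symm.trans
    (((reflectorAdjunction toRng.{u}).homEquiv Q X).symm_apply_eq.1
      ((reflectorAdjunction toRng.{u}).homEquiv_counit _ _ _)).symm

theorem isIso_map_counit {B Q : Rng.{u}} {X : RedCRng.{u}}
    {φ : X ⟶ (reflector toRng.{u}).obj B} (hφ : Function.Surjective (toRng.map φ).hom)
    {π₁ : Q ⟶ B} {π₂ : Q ⟶ toRng.obj X} (h : IsPullback π₁ π₂ (unit B) (toRng.map φ)) :
    IsIso ((reflector toRng).map π₂ ≫ (reflectorAdjunction toRng).counit.app X) := by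
  have hη := Rng.congr_elem (unit_map_counit π₂)
  have hπ : Function.Surjective π₁.hom := fun b => by
    obtain ⟨x, hx⟩ := hφ ((unit B).hom b)
    obtain ⟨q, hq, -⟩ := Rng.exists_of_isPullback h hx.symm
    exact ⟨q, hq⟩
  have : IsIso (toRng.map ((reflector toRng).map π₂ ≫
      (reflectorAdjunction toRng).counit.app X)) := by
    refine Rng.isIso_of_bijective _ ⟨(injective_iff_map_eq_zero _).2 fun x hx => ?_, fun x => ?_⟩
    · obtain ⟨q, rfl⟩ := unit_surjective Q x
      have h₂ : π₂.hom q = 0 := (hη q).symm.trans hx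
      have h₁ : (unit B).hom (π₁.hom q) = 0 := by
        refine (Rng.congr_elem h.w q).trans ?_
        exact (congrArg (toRng.map φ).hom h₂).trans (map_zero _)
      exact unit_eq_zero_iff.2 (Rng.mem_relativeRadical_top_of_isPullback h hπ X.obj.property
        (unit_eq_zero_iff.1 h₁) h₂)
    · obtain ⟨b, hb⟩ := unit_surjective B ((toRng.map φ).hom x)
      obtain ⟨q, -, hq⟩ := Rng.exists_of_isPullback h hb
      exact ⟨(unit Q).hom q, (hη q).trans hq⟩
  exact isIso_of_reflects_iso _ toRng

theorem admissible : galoisStructure.{u}.Admissible := fun _ _ _ hφ _ _ _ h =>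
  isIso_map_counit ((Rng.isRegularEpi_iff_surjective _).1 hφ) h

theorem exact_map_reflector {K A B : CRng.{u}} {k : K ⟶ A} {f : A ⟶ B} {s : B ⟶ A}
    (hs : s ≫ f = 𝟙 B) (hk : Function.Exact k.hom.hom f.hom.hom) :
    Function.Exact (toRng.map ((reflector inclusion).map k)).hom
      (toRng.map ((reflector inclusion).map f)).hom := by
  have hs (b : B.obj) : f.hom.hom (s.hom.hom b) = b :=
    Rng.congr_elem (congrArg (fun g => g.hom) hs) b
  refine fun x => ⟨fun hx => ?_, ?_⟩
  · obtain ⟨a, rfl⟩ := reductionMap_surjective A x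
    rw [map_reductionMap] at hx
    obtain ⟨n, hn⟩ := reductionMap_eq_zero_iff.1 hx
    obtain ⟨z, hz⟩ := (hk (a - s.hom.hom (f.hom.hom a))).1 (by rw [map_sub, hs, sub_self])
    have hsa : (reductionMap A).hom (s.hom.hom (f.hom.hom a)) = 0 :=
      reductionMap_eq_zero_iff.2 ⟨n, by rw [← map_ppow, hn, map_zero]⟩
    exact ⟨(reductionMap K).hom z, by rw [map_reductionMap, hz, map_sub, hsa, sub_zero]⟩
  · rintro ⟨y, rfl⟩
    obtain ⟨z, rfl⟩ := reductionMap_surjective K y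
    rw [map_reductionMap, map_reductionMap, (hk _).2 ⟨z, rfl⟩, map_zero]

theorem injective_map_reflector {K A : CRng.{u}} {k : K ⟶ A}
    (hk : Function.Injective k.hom.hom) :
    Function.Injective (toRng.map ((reflector inclusion).map k)).hom := by
  refine (injective_iff_map_eq_zero _).2 fun x hx => ?_
  obtain ⟨z, rfl⟩ := reductionMap_surjective K x
  rw [map_reductionMap] at hx
  obtain ⟨n, hn⟩ := reductionMap_eq_zero_iff.1 hx
  exact reductionMap_eq_zero_iff.2 ⟨n, hk (by rw [map_ppow, hn, map_zero])⟩

open ZeroObject in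
theorem protoadditive : Protoadditive (reflector inclusion.{u}) := by
  intro K A B k f s h
  have h0 : IsZero ((reflector inclusion.{u}).obj 0) :=
    have hI := (isZero_zero CRng.{u}).isInitial.isInitialObj (reflector inclusion)
    (isZero_zero RedCRng.{u}).of_iso (hI.uniqueUpToIso (isZero_zero _).isInitial)
  have hk : IsPullback ((reflector inclusion).map k)
      ((reflector inclusion).map ((isZero_zero CRng).from_ K)) ((reflector inclusion).map f)
      ((reflector inclusion).map ((isZero_zero CRng).to_ B)) := by
    have := Rng.subsingleton_obj_of_isZero CRng.inclusion (isZero_zero CRng.{u})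
    have := Rng.subsingleton_obj_of_isZero toRng h0
    obtain ⟨hinj, hex⟩ := Rng.isPullback_iff_exact.1 (h.isKernel.map CRng.inclusion)
    refine IsPullback.of_map toRng ?_ (Rng.isPullback_iff_exact.2
      ⟨injective_map_reflector hinj, exact_map_reflector h.section_comp hex⟩)
    rw [← Functor.map_comp, h.isKernel.w, Functor.map_comp]
  have hc := h.isCokernel.map (reflector inclusion)
  let e := h0.iso (isZero_zero RedCRng.{u})
  exact ⟨by rw [← Functor.map_comp, h.section_comp, CategoryTheory.Functor.map_id],
    hk.of_iso (Iso.refl _) (Iso.refl _) e (Iso.refl _) (by simp)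
      ((isZero_zero _).eq_of_tgt _ _) (by simp) (h0.eq_of_src _ _),
    hc.of_iso (Iso.refl _) (Iso.refl _) e (Iso.refl _) (by simp)
      ((isZero_zero _).eq_of_tgt _ _) (by simp) (h0.eq_of_src _ _)⟩

end RedCRng

/-! ### Monadicity of pulling back extensions -/

namespace RedCRng

/-- The category of extensions (regular epimorphisms) over a ring. -/
abbrev Ext (B : Rng.{u}) := galoisStructure.{u}.ℰ.Over ⊤ B

/-- Pulling back extensions along `p`. -/
noncomputable abbrev extPullback {E B : Rng.{u}} (p : E ⟶ B) : Ext B ⥤ Ext E :=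
  MorphismProperty.Over.pullback galoisStructure.{u}.ℰ ⊤ p

theorem Ext.hom_surjective {B : Rng.{u}} (X : Ext B) : Function.Surjective X.hom.hom :=
  (Rng.isRegularEpi_iff_surjective _).1 X.prop

/-- The ideal generated by the differences of the values of two homomorphisms. -/
def differenceIdeal {X Y : Rng.{u}} (f g : X ⟶ Y) : TwoSidedIdeal Y :=
  TwoSidedIdeal.span {z | ∃ x, z = f.hom x - g.hom x}

theorem differenceIdeal_le_ker {X Y Z : Rng.{u}} {f g : X ⟶ Y} {h : Y ⟶ Z} (w : f ≫ h = g ≫ h)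
    {y : Y} (hy : y ∈ differenceIdeal f g) : h.hom y = 0 := by
  have hle : differenceIdeal f g ≤ TwoSidedIdeal.ker h.hom := by
    refine TwoSidedIdeal.span_le.2 ?_
    rintro _ ⟨x, rfl⟩
    rw [SetLike.mem_coe, TwoSidedIdeal.mem_ker, map_sub, sub_eq_zero]
    exact Rng.congr_elem w x
  exact (TwoSidedIdeal.mem_ker (f := h.hom)).1 (hle hy)

section Coequalizers

variable {B : Rng.{u}} {X Y : Ext B} (f g : X ⟶ Y)

theorem nonempty_isColimit_cofork {Q : Ext B} (c : Y ⟶ Q) (w : f ≫ c = g ≫ c)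
    (hc : Function.Surjective c.left.hom)
    (hker : ∀ y, c.left.hom y = 0 → y ∈ differenceIdeal f.left g.left) :
    Nonempty (IsColimit (Cofork.ofπ c w)) := by
  have hd : ∀ s : Cofork f g, ∃ d : Q.left ⟶ s.pt.left, c.left ≫ d = s.π.left := fun s =>
    Rng.exists_desc hc _ fun y hy => differenceIdeal_le_ker
      (congrArg (fun k => k.left) s.condition) (hker y hy)
  choose d hd using hd
  refine ⟨Cofork.IsColimit.mk _ (fun s => MorphismProperty.Over.homMk (d s) ?_) ?_ ?_⟩
  · refine Rng.elem_ext fun q => ?_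
    obtain ⟨y, rfl⟩ := hc q
    have h₁ := Rng.congr_elem (hd s) y
    have h₂ := Rng.congr_elem (MorphismProperty.Over.w s.π) y
    have h₃ := Rng.congr_elem (MorphismProperty.Over.w c) y
    exact ((congrArg s.pt.hom.hom h₁).trans h₂).trans h₃.symm
  · intro s
    exact MorphismProperty.Over.Hom.ext (hd s)
  · intro s m hm
    refine MorphismProperty.Over.Hom.ext (Rng.elem_ext fun q => ?_)
    obtain ⟨y, rfl⟩ := hc q
    exact (Rng.congr_elem (congrArg (fun k => k.left) hm) y).trans
      (Rng.congr_elem (hd s) y).symm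

/-- The coequalizer of two morphisms of extensions. -/
def extCoequalizer : Ext B :=
  MorphismProperty.Over.mk ⊤
    (Rng.ofHom (A := (differenceIdeal f.left g.left).Quo) (B := B)
      ((differenceIdeal f.left g.left).quotLift Y.hom.hom fun _ ha =>
        differenceIdeal_le_ker ((MorphismProperty.Over.w f).trans
          (MorphismProperty.Over.w g).symm) ha))
    ((Rng.isRegularEpi_iff_surjective _).2 fun b => by
      obtain ⟨y, hy⟩ := Y.hom_surjective b
      exact ⟨TwoSidedIdeal.quotMk _ y, hy⟩)

/-- The projection to the coequalizer of two morphisms of extensions. -/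
def extCoequalizerπ : Y ⟶ extCoequalizer f g :=
  MorphismProperty.Over.homMk
    (Rng.ofHom (B := (differenceIdeal f.left g.left).Quo) (TwoSidedIdeal.quotMk _))

theorem extCoequalizer_condition : f ≫ extCoequalizerπ f g = g ≫ extCoequalizerπ f g := by
  refine MorphismProperty.Over.Hom.ext (Rng.elem_ext fun x => ?_)
  refine sub_eq_zero.1 ((map_sub (TwoSidedIdeal.quotMk _) _ _).symm.trans ?_)
  exact (TwoSidedIdeal.quotMk_eq_zero _ _).2 (TwoSidedIdeal.subset_span ⟨x, rfl⟩)

noncomputable def extCoequalizerIsColimit :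
    IsColimit (Cofork.ofπ (extCoequalizerπ f g) (extCoequalizer_condition f g)) :=
  (nonempty_isColimit_cofork f g _ _ (TwoSidedIdeal.quotMk_surjective _)
    fun y hy => (TwoSidedIdeal.quotMk_eq_zero _ y).1 hy).some

end Coequalizers

section Pullback

variable {E B : Rng.{u}} (p : E ⟶ B)

/-- The projection of a pulled back extension. -/
noncomputable def extFst (X : Ext B) : ((extPullback p).obj X).left ⟶ X.left :=
  pullback.fst X.hom p

theorem isPullback_extFst (X : Ext B) :
    IsPullback (extFst p X) ((extPullback p).obj X).hom X.hom p :=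
  IsPullback.of_hasPullback _ _

theorem extFst_naturality {X Y : Ext B} (h : X ⟶ Y) (z : ((extPullback p).obj X).left) :
    (extFst p Y).hom (((extPullback p).map h).left.hom z) = h.left.hom ((extFst p X).hom z) :=
  Rng.congr_elem (pullback.lift_fst _ _ _) z

theorem ext_w_apply {X Y : Ext B} (h : X ⟶ Y) (z : X.left) :
    Y.hom.hom (h.left.hom z) = X.hom.hom z :=
  Rng.congr_elem (MorphismProperty.Over.w h) z

variable {p}

theorem extFst_surjective (hp : Function.Surjective p.hom) (X : Ext B) :
    Function.Surjective (extFst p X).hom := fun x => by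
  obtain ⟨e, he⟩ := hp (X.hom.hom x)
  obtain ⟨z, hz, -⟩ := Rng.exists_of_isPullback (isPullback_extFst p X) he.symm
  exact ⟨z, hz⟩

theorem mem_differenceIdeal_map (hp : Function.Surjective p.hom) {X Y : Ext B} (f g : X ⟶ Y)
    {z : ((extPullback p).obj Y).left}
    (hz : (extFst p Y).hom z ∈ differenceIdeal f.left g.left)
    (hz₀ : ((extPullback p).obj Y).hom.hom z = 0) :
    z ∈ differenceIdeal ((extPullback p).map f).left ((extPullback p).map g).left := by
  have hY := extFst_surjective hp Y
  have hle : differenceIdeal f.left g.left ≤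
      (differenceIdeal ((extPullback p).map f).left ((extPullback p).map g).left).map
        (extFst p Y).hom := by
    refine TwoSidedIdeal.span_le.2 ?_
    rintro _ ⟨x, rfl⟩
    obtain ⟨t, rfl⟩ := extFst_surjective hp X x
    exact (Rng.mem_map_of_surjective hY).2 ⟨_, TwoSidedIdeal.subset_span ⟨t, rfl⟩, by
      rw [map_sub, extFst_naturality, extFst_naturality]⟩
  obtain ⟨t, ht, htz⟩ := (Rng.mem_map_of_surjective hY).1 (hle hz)
  have ht₀ : ((extPullback p).obj Y).hom.hom t = 0 :=
    differenceIdeal_le_ker ((MorphismProperty.Over.w ((extPullback p).map f)).trans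
      (MorphismProperty.Over.w ((extPullback p).map g)).symm) ht
  rwa [← Rng.ext_of_isPullback (isPullback_extFst p Y) htz (ht₀.trans hz₀.symm)]

theorem nonempty_isColimit_map_cofork (hp : Function.Surjective p.hom) {X Y : Ext B}
    (f g : X ⟶ Y) :
    Nonempty (IsColimit (Cofork.ofπ
      ((extPullback p).map (extCoequalizerπ f g))
      (by rw [← Functor.map_comp, extCoequalizer_condition, Functor.map_comp]) :
        Cofork ((extPullback p).map f) ((extPullback p).map g))) := by
  apply nonempty_isColimit_cofork
  · intro z
    obtain ⟨y, hy⟩ := TwoSidedIdeal.quotMk_surjective _ ((extFst p (extCoequalizer f g)).hom z)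
    have hw := Rng.congr_elem (isPullback_extFst p (extCoequalizer f g)).w z
    obtain ⟨t, h₁, h₂⟩ := Rng.exists_of_isPullback (isPullback_extFst p Y) (x := y)
      ((congrArg (extCoequalizer f g).hom.hom hy).trans hw)
    refine ⟨t, Rng.ext_of_isPullback (isPullback_extFst p _) ?_ ?_⟩
    · rw [extFst_naturality, h₁]
      exact hy
    · rw [ext_w_apply, h₂]
      rfl
  · intro z hz
    refine mem_differenceIdeal_map hp f g ?_ ?_
    · refine (TwoSidedIdeal.quotMk_eq_zero _ _).1
        ((extFst_naturality p (extCoequalizerπ f g) z).symm.trans ?_)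
      exact (congrArg (extFst p (extCoequalizer f g)).hom hz).trans (map_zero _)
    · rw [← ext_w_apply ((extPullback p).map (extCoequalizerπ f g)), hz, map_zero]

theorem ext_isIso_of_bijective {X Y : Ext B} (h : X ⟶ Y) (hh : Function.Bijective h.left.hom) :
    IsIso h := by
  have := Rng.isIso_of_bijective _ hh
  exact (MorphismProperty.Over.isoMk (asIso h.left) (MorphismProperty.Over.w h)).isIso_hom

theorem reflectsIsomorphisms_extPullback (hp : Function.Surjective p.hom) :
    (extPullback p).ReflectsIsomorphisms where
  reflects {X Y} h _ := by
    have hbij : Function.Bijective ((extPullback p).map h).left.hom :=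
      Rng.bijective_of_isIso ((MorphismProperty.Over.forget _ _ _ ⋙ Over.forget _).map
        ((extPullback p).map h))
    refine ext_isIso_of_bijective h ⟨(injective_iff_map_eq_zero _).2 fun x hx => ?_, fun y => ?_⟩
    · obtain ⟨t, ht, ht₀⟩ := Rng.exists_of_isPullback (isPullback_extFst p X) (x := x) (y := 0)
        (by rw [← ext_w_apply h, hx, map_zero, map_zero])
      have : t = 0 := hbij.1 (Rng.ext_of_isPullback (isPullback_extFst p Y)
        (by rw [extFst_naturality, ht, hx, map_zero, map_zero])
        (by rw [ext_w_apply, ht₀, map_zero, map_zero]))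
      rw [← ht, this, map_zero]
    · obtain ⟨z, rfl⟩ := extFst_surjective hp Y y
      obtain ⟨t, rfl⟩ := hbij.2 z
      exact ⟨_, (extFst_naturality p h t).symm⟩

theorem isMonadicExtension {p : E ⟶ B} (hp : Function.Surjective p.hom) :
    galoisStructure.{u}.IsMonadicExtension p := by
  have hE : galoisStructure.{u}.ℰ p := (Rng.isRegularEpi_iff_surjective p).2 hp
  refine ⟨hE, ⟨?_⟩⟩
  have : (extPullback p).ReflectsIsomorphisms := reflectsIsomorphisms_extPullback hp
  have : Monad.HasCoequalizerOfIsSplitPair (extPullback p) :=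
    ⟨fun f g _ => ⟨⟨_, extCoequalizerIsColimit f g⟩⟩⟩
  have : Monad.PreservesColimitOfIsSplitPair (extPullback p) :=
    ⟨fun f g _ => preservesColimit_of_preserves_colimit_cocone (extCoequalizerIsColimit f g)
      ((isColimitMapCoconeCoforkEquiv (extPullback p) _).symm
        (nonempty_isColimit_map_cofork hp f g).some)⟩
  exact Monad.monadicOfHasPreservesGSplitCoequalizersOfReflectsIsomorphisms
    (MorphismProperty.Over.mapPullbackAdj galoisStructure.{u}.ℰ ⊤ p hE trivial)

end Pullback

end RedCRng

/-! ### Normal extensions -/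

namespace RedCRng

open Rng

section KernelPair

variable {R E B : Rng.{u}}

theorem isTrivialExtension_iff_of_section {π : R ⟶ E} {δ : E ⟶ R} (hδ : δ ≫ π = 𝟙 E) :
    galoisStructure.{u}.IsTrivialExtension π ↔ ∀ r ∈ relativeRadical ⊤, π.hom r = 0 → r = 0 := by
  have hδ := congr_elem hδ
  refine ⟨fun ⟨_, hπ⟩ r hr hr₀ => ?_, fun h => ⟨?_, ?_⟩⟩
  · exact ext_of_isPullback hπ ((unit_eq_zero_iff.2 hr).trans (map_zero _).symm)
      (hr₀.trans (map_zero _).symm)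
  · exact (isRegularEpi_iff_surjective π).2 fun a => ⟨δ.hom a, hδ a⟩
  · refine isPullback_of_forall_exists ((reflectorAdjunction toRng.{u}).unit.naturality π).symm
      (fun r hr hr₀ => h r (unit_eq_zero_iff.1 hr) hr₀) fun x a hxa => ?_
    obtain ⟨r, rfl⟩ : ∃ r : R, (unit R).hom r = x := unit_surjective R x
    have hra : (unit E).hom (π.hom r - a) = 0 := by
      rw [map_sub, sub_eq_zero]
      exact (map_unit π r).symm.trans hxa
    refine ⟨r - δ.hom (π.hom r - a), ?_, ?_⟩
    · refine (map_sub (unit R).hom _ _).trans ?_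
      rw [← map_unit, hra, map_zero, sub_zero]
    · rw [map_sub, show π.hom (δ.hom (π.hom r - a)) = π.hom r - a from hδ _, sub_sub_cancel]

variable {p : E ⟶ B} {π₁ π₂ : R ⟶ E}

theorem exists_diagonal (h : IsPullback π₁ π₂ p p) : ∃ δ : E ⟶ R, δ ≫ π₁ = 𝟙 E ∧ δ ≫ π₂ = 𝟙 E :=
  ⟨h.lift (𝟙 E) (𝟙 E) rfl, h.lift_fst _ _ _, h.lift_snd _ _ _⟩

theorem isTrivialExtension_fst_iff (h : IsPullback π₁ π₂ p p) :
    galoisStructure.{u}.IsTrivialExtension π₁ ↔ relativeRadical (kernelIdeal p) = ⊥ := by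
  obtain ⟨δ, hδ, -⟩ := exists_diagonal h
  rw [isTrivialExtension_iff_of_section hδ, eq_bot_iff]
  constructor
  · intro hR k hk
    obtain ⟨r, hr, rfl⟩ := exists_of_isPullback h (x := 0) (y := k)
      ((map_zero _).trans (mem_kernelIdeal.1 (relativeRadical_le hk)).symm)
    rw [hR r ((mem_relativeRadical_kernelPair_iff h hr).2 hk) hr, map_zero]
    exact TwoSidedIdeal.zero_mem _
  · intro hE r hr hr₁
    refine ext_of_isPullback h (hr₁.trans (map_zero _).symm) ?_
    rw [map_zero]
    exact (TwoSidedIdeal.mem_bot E).1 (hE ((mem_relativeRadical_kernelPair_iff h hr₁).1 hr))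

theorem isNormalExtension_iff : galoisStructure.{u}.IsNormalExtension p ↔
    Function.Surjective p.hom ∧ relativeRadical (kernelIdeal p) = ⊥ := by
  refine and_congr ⟨fun hp => (isRegularEpi_iff_surjective p).1 hp.1, isMonadicExtension⟩ ?_
  exact ⟨fun h => (isTrivialExtension_fst_iff (isPullback_fibreProduct p p)).1
    (h _ _ _ (isPullback_fibreProduct p p)), fun h _ _ _ hR => (isTrivialExtension_fst_iff hR).2 h⟩

end KernelPair

end RedCRng

namespace Rng

section OverMap

variable {E E' B : Rng.{u}} {p : E ⟶ B} {p' : E' ⟶ B}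

theorem apply_eq_apply_of_comp_eq (hp' : relativeRadical (kernelIdeal p') = ⊥) {φ ψ : E ⟶ E'}
    (h : φ ≫ p' = ψ ≫ p') {z : E} (hz : z ∈ relativeRadical ⊤) : φ.hom z = ψ.hom z := by
  have hK (a : E) : φ.hom a - ψ.hom a ∈ kernelIdeal p' := by
    rw [mem_kernelIdeal, map_sub, sub_eq_zero]
    exact congr_elem h a
  have hsub := map_sub_map_mem_relativeRadical hK hz
  rwa [hp', TwoSidedIdeal.mem_bot, sub_eq_zero] at hsub

/-- The homomorphism `Ker p ∧ √[E, E] → Ker p' ∧ √[E', E']` induced by a homomorphism over `B`. -/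
def hopfNumeratorMap (w : E ⟶ E') (hw : p = w ≫ p') : hopfNumerator p →ₙ+* hopfNumerator p' where
  toFun a := ⟨w.hom a, mem_hopfNumerator.2
    ⟨(congr_elem hw a).symm.trans (mem_hopfNumerator.1 a.2).1,
      map_mem_relativeRadical w.hom le_top (mem_hopfNumerator.1 a.2).2⟩⟩
  map_zero' := Subtype.ext (map_zero w.hom)
  map_add' x y := Subtype.ext (map_add w.hom (x : E) (y : E))
  map_mul' x y := Subtype.ext (map_mul w.hom (x : E) (y : E))

theorem nonempty_iso_hopfNumerator (hp : relativeRadical (kernelIdeal p) = ⊥)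
    (hp' : relativeRadical (kernelIdeal p') = ⊥) {w : E ⟶ E'} {w' : E' ⟶ E} (hw : p = w ≫ p')
    (hw' : p' = w' ≫ p) : Nonempty (of (hopfNumerator p) ≅ of (hopfNumerator p')) := by
  have h : (w ≫ w') ≫ p = 𝟙 E ≫ p := by rw [Category.assoc, ← hw', ← hw, Category.id_comp]
  have h' : (w' ≫ w) ≫ p' = 𝟙 E' ≫ p' := by rw [Category.assoc, ← hw, ← hw', Category.id_comp]
  exact ⟨⟨ofHom (hopfNumeratorMap w hw), ofHom (hopfNumeratorMap w' hw'),
    elem_ext fun a => Subtype.ext (apply_eq_apply_of_comp_eq hp h (mem_hopfNumerator.1 a.2).2),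
    elem_ext fun a => Subtype.ext (apply_eq_apply_of_comp_eq hp' h' (mem_hopfNumerator.1 a.2).2)⟩⟩

end OverMap

/-! ### The extension of a presentation -/

section Presentation

variable {P B : Rng.{u}} (f : P ⟶ B)

/-- The extension `P / √[K, P] ⟶ B` induced by `f : P ⟶ B` with kernel `K`. It is the weakly
universal normal extension of `B` when `f` is a projective presentation. -/
def presentationExtension : of (relativeRadical (kernelIdeal f)).Quo ⟶ B :=
  ofHom (B := B) ((relativeRadical (kernelIdeal f)).quotLift f.hom fun _ ha =>
    mem_kernelIdeal.1 (relativeRadical_le ha))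

/-- The projection `P ⟶ P / √[K, P]`. -/
def presentationProjection : P ⟶ of (relativeRadical (kernelIdeal f)).Quo :=
  ofHom (A := P) (relativeRadical (kernelIdeal f)).quotMk

theorem presentationProjection_comp : presentationProjection f ≫ presentationExtension f = f :=
  rfl

theorem presentationProjection_surjective : Function.Surjective (presentationProjection f).hom :=
  TwoSidedIdeal.quotMk_surjective _

theorem presentationProjection_eq_zero_iff {a : P} :
    (presentationProjection f).hom a = 0 ↔ a ∈ relativeRadical (kernelIdeal f) :=
  TwoSidedIdeal.quotMk_eq_zero _ a

theorem relativeRadical_kernelIdeal_presentationExtension :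
    relativeRadical (kernelIdeal (presentationExtension f)) = ⊥ := by
  have hK : (kernelIdeal (presentationExtension f)).comap (presentationProjection f).hom =
      kernelIdeal f :=
    TwoSidedIdeal.ext fun a => (TwoSidedIdeal.mem_comap _).trans
      (mem_kernelIdeal.trans (mem_kernelIdeal (f := f)).symm)
  refine eq_bot_iff.2 fun x hx => ?_
  obtain ⟨a, rfl⟩ := presentationProjection_surjective f x
  rw [map_mem_relativeRadical_iff (presentationProjection_surjective f) fun b hb => by
    rwa [hK, ← presentationProjection_eq_zero_iff], hK] at hx
  exact (TwoSidedIdeal.mem_bot _).2 ((presentationProjection_eq_zero_iff f).2 hx)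

theorem nonempty_hopfQuotient_iso :
    Nonempty (hopfQuotient f ≅ of (hopfNumerator (presentationExtension f))) := by
  refine nonempty_quo_iso (hopfNumeratorMap _ (presentationProjection_comp f).symm) ?_ fun a =>
    Subtype.ext_iff.trans ((presentationProjection_eq_zero_iff f).trans mem_hopfDenominator.symm)
  rintro ⟨x, hx⟩
  obtain ⟨a, rfl⟩ := presentationProjection_surjective f x
  obtain ⟨ha, hrad⟩ := mem_hopfNumerator.1 hx
  rw [map_mem_relativeRadical_iff (presentationProjection_surjective f) fun b hb =>
    map_mem_relativeRadical (NonUnitalRingHom.id P) (fun _ _ => TwoSidedIdeal.mem_top _)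
      ((presentationProjection_eq_zero_iff f).1 hb)] at hrad
  have hrad : a ∈ relativeRadical ⊤ :=
    map_mem_relativeRadical (NonUnitalRingHom.id P) le_top hrad
  exact ⟨⟨a, mem_hopfNumerator.2 ⟨ha, hrad⟩⟩, rfl⟩

variable {f}

theorem exists_presentationExtension_eq_comp {E : Rng.{u}} {p : E ⟶ B}
    (hp : relativeRadical (kernelIdeal p) = ⊥) {g : P ⟶ E} (hg : g ≫ p = f) :
    ∃ w, presentationExtension f = w ≫ p := by
  have hK : kernelIdeal f ≤ (kernelIdeal p).comap g.hom := fun k hk =>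
    (TwoSidedIdeal.mem_comap _).2 (mem_kernelIdeal.2
      ((congr_elem hg k).trans (mem_kernelIdeal.1 hk)))
  obtain ⟨w, hw⟩ := exists_desc (presentationProjection_surjective f) g fun a ha => by
    rw [presentationProjection_eq_zero_iff] at ha
    have hga := map_mem_relativeRadical g.hom hK ha
    rwa [hp, TwoSidedIdeal.mem_bot] at hga
  refine ⟨w, elem_ext fun x => ?_⟩
  obtain ⟨a, rfl⟩ := presentationProjection_surjective f x
  exact (congr_elem hg a).symm.trans (congrArg p.hom (congr_elem hw a)).symm

end Presentation

/-- Projectivity with respect to regular epimorphisms, i.e. surjective homomorphisms. Mathlib's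
`CategoryTheory.Projective` is stronger, since epimorphisms of rings need not be surjective. -/
def IsRegularProjective (P : Rng.{u}) : Prop :=
  ∀ ⦃E B : Rng.{u}⦄ (p : E ⟶ B) (f : P ⟶ B), IsRegularEpi p → ∃ g : P ⟶ E, g ≫ p = f

theorem IsFree.isRegularProjective {P : Rng.{u}} (hP : P.IsFree) : P.IsRegularProjective := by
  intro E B p f hp
  rw [isRegularEpi_iff_surjective] at hp
  obtain ⟨X, ι, h⟩ := hP
  obtain ⟨g, hg, -⟩ := h E fun x => Function.surjInv hp (f.hom (ι x))
  refine ⟨g, (h B fun x => f.hom (ι x)).unique (fun x => ?_) fun _ => rfl⟩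
  exact (congrArg p.hom (hg x)).trans (Function.surjInv_eq hp _)

end Rng

namespace RedCRng

open Rng

theorem isWeaklyUniversalNormalExtension_presentationExtension {P B : Rng.{u}}
    (hP : P.IsRegularProjective) {f : P ⟶ B} (hf : IsRegularEpi f) :
    galoisStructure.{u}.IsWeaklyUniversalNormalExtension (presentationExtension f) := by
  refine ⟨isNormalExtension_iff.2 ⟨fun b => ?_,
    relativeRadical_kernelIdeal_presentationExtension f⟩, fun E p hp => ?_⟩
  · obtain ⟨a, ha⟩ := (isRegularEpi_iff_surjective f).1 hf b
    exact ⟨(presentationProjection f).hom a, ha⟩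
  · obtain ⟨g, hg⟩ := hP p f hp.1.1
    exact exists_presentationExtension_eq_comp (isNormalExtension_iff.1 hp).2 hg

/-! ### The Galois group -/

section GaloisGroup

variable {R E B : Rng.{u}} {p : E ⟶ B} {π₁ π₂ : R ⟶ E}

theorem exists_hopfNumerator_hom (h : IsPullback π₁ π₂ p p) :
    ∃ j : of (hopfNumerator p) ⟶ R, ∀ a : hopfNumerator p,
      π₁.hom (j.hom a) = 0 ∧ π₂.hom (j.hom a) = a := by
  let ι : of (hopfNumerator p) ⟶ E := ⟨(hopfNumerator p).incl⟩
  let z : of (hopfNumerator p) ⟶ E := ⟨0⟩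
  have w : z ≫ p = ι ≫ p := elem_ext fun a =>
    (map_zero p.hom).trans (mem_hopfNumerator.1 a.2).1.symm
  exact ⟨h.lift z ι w, fun a => ⟨congr_elem (h.lift_fst z ι w) a, congr_elem (h.lift_snd z ι w) a⟩⟩

variable (h : IsPullback π₁ π₂ p p) {j : of (hopfNumerator p) ⟶ R}
  (hj : ∀ a : hopfNumerator p, π₁.hom (j.hom a) = 0 ∧ π₂.hom (j.hom a) = a)
include h hj

theorem injective_unit_kernelPair (hp : relativeRadical (kernelIdeal p) = ⊥) :
    Function.Injective (j ≫ unit R).hom := by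
  refine (injective_iff_map_eq_zero _).2 fun a ha => Subtype.ext ?_
  have ha := (mem_relativeRadical_kernelPair_iff h (hj a).1).1 (unit_eq_zero_iff.1 ha)
  rwa [hp, TwoSidedIdeal.mem_bot, (hj a).2] at ha

theorem exact_unit_kernelPair : Function.Exact (j ≫ unit R).hom
    (toRng.map (prod.lift ((reflector toRng).map π₁) ((reflector toRng).map π₂))).hom := by
  refine fun x => (map_prodLift_eq_zero_iff toRng _ _ x).trans ⟨fun ⟨h₁, h₂⟩ => ?_, ?_⟩
  · obtain ⟨r, rfl⟩ : ∃ r : R, (unit R).hom r = x := unit_surjective R x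
    rw [map_unit] at h₁ h₂
    obtain ⟨δ, hδ₁, hδ₂⟩ := exists_diagonal h
    have hr : π₂.hom r - π₁.hom r ∈ hopfNumerator p :=
      mem_hopfNumerator.2 ⟨mem_kernelIdeal.1 (sub_mem_kernelIdeal_of_isPullback h r),
        unit_eq_zero_iff.1 (by rw [map_sub, h₁, h₂, sub_zero])⟩
    -- Modulo the diagonal, `r = (x, y)` is `(0, y - x)`, and the diagonal part dies in `FI(R)`.
    have hjr : j.hom ⟨_, hr⟩ = r - δ.hom (π₁.hom r) := by
      have hδ₁ : π₁.hom (δ.hom (π₁.hom r)) = π₁.hom r := congr_elem hδ₁ _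
      have hδ₂ : π₂.hom (δ.hom (π₁.hom r)) = π₁.hom r := congr_elem hδ₂ _
      refine ext_of_isPullback h ?_ ?_
      · rw [(hj _).1, map_sub, hδ₁, sub_self]
      · rw [(hj _).2, map_sub, hδ₂]
    refine ⟨⟨_, hr⟩, (congrArg (unit R).hom hjr).trans ((map_sub (unit R).hom _ _).trans ?_)⟩
    rw [← map_unit δ, h₁, map_zero, sub_zero]
  · rintro ⟨a, rfl⟩
    have hπ (π : R ⟶ E) : (toRng.map ((reflector toRng).map π)).hom ((j ≫ unit R).hom a) =
        (unit E).hom (π.hom (j.hom a)) := map_unit π (j.hom a)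
    rw [hπ, hπ, (hj a).1, (hj a).2]
    exact ⟨map_zero _, unit_eq_zero_iff.2 (mem_hopfNumerator.1 a.2).2⟩

omit h hj

theorem nonempty_galoisGroup_iso (hp : relativeRadical (kernelIdeal p) = ⊥) :
    Nonempty (toRng.obj (galoisStructure.{u}.galoisGroup p) ≅ of (hopfNumerator p)) := by
  have h := IsPullback.of_hasPullback p p
  obtain ⟨j, hj⟩ := exists_hopfNumerator_hom h
  have := subsingleton_obj_of_isZero toRng (isZero_zero RedCRng.{u})
  have hker : IsPullback (j ≫ unit _) ⟨0⟩ (toRng.map (prod.lift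
      ((reflector toRng).map (pullback.fst p p)) ((reflector toRng).map (pullback.snd p p))))
      (toRng.map ((isZero_zero RedCRng.{u}).to_ _)) :=
    isPullback_iff_exact.2 ⟨injective_unit_kernelPair h hj hp, exact_unit_kernelPair h hj⟩
  exact ⟨((IsPullback.of_hasPullback _ _).map toRng).isoIsPullback _ _ hker⟩

end GaloisGroup

theorem nonempty_galoisGroup_iso_hopfQuotient {P E B : Rng.{u}} {f : P ⟶ B}
    (hf : galoisStructure.{u}.IsWeaklyUniversalNormalExtension (presentationExtension f))
    {p : E ⟶ B} (hp : galoisStructure.{u}.IsWeaklyUniversalNormalExtension p) :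
    Nonempty (toRng.obj (galoisStructure.{u}.galoisGroup p) ≅ hopfQuotient f) := by
  obtain ⟨w, hw⟩ := hp.2 _ _ hf.1
  obtain ⟨w', hw'⟩ := hf.2 _ _ hp.1
  have hp₀ := (isNormalExtension_iff.1 hp.1).2
  obtain ⟨e₁⟩ := nonempty_galoisGroup_iso hp₀
  obtain ⟨e₂⟩ := nonempty_iso_hopfNumerator hp₀ (isNormalExtension_iff.1 hf.1).2 hw hw'
  obtain ⟨e₃⟩ := nonempty_hopfQuotient_iso f
  exact ⟨e₁ ≪≫ e₂ ≪≫ e₃.symm⟩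

end RedCRng

theorem mainTheorem9_general :
    RedCRng.galoisStructure.{u}.Admissible ∧
    Protoadditive (reflector RedCRng.inclusion.{u}) ∧
    (∀ (A : CRng.{u}) (J : TwoSidedIdeal A.obj),
      CRng.closure RedCRng.inclusion.{u} A J = J.radical (A.commutator_mem J)) ∧
    ∀ (B P : Rng.{u}) (f : P ⟶ B),
      Rng.relativeCommutator CRng.inclusion.{u} ((isZero_zero Rng.{u}).from_ P) =
        (TwoSidedIdeal.commutatorIdeal P : Set P) ∧
      Rng.relativeCommutator CRng.inclusion.{u} f =
        ((Rng.kernelIdeal f).commutatorWith : Set P) ∧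
      Rng.closure RedCRng.toRng.{u} (TwoSidedIdeal.commutatorIdeal P) = P.radicalCommutator ∧
      Rng.closure RedCRng.toRng.{u} (Rng.kernelIdeal f).commutatorIn =
        Rng.kernelRadicalCommutator f ∧
      (∀ k ∈ Rng.kernelRadicalCommutator f, (k : P) ∈ Rng.hopfNumerator f) ∧
      (P.IsRegularProjective → IsRegularEpi f →
        (∃ (E : Rng.{u}) (p : E ⟶ B),
          RedCRng.galoisStructure.{u}.IsWeaklyUniversalNormalExtension p) ∧
        ∀ (E : Rng.{u}) (p : E ⟶ B),
          RedCRng.galoisStructure.{u}.IsWeaklyUniversalNormalExtension p →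
          Nonempty (RedCRng.toRng.obj (RedCRng.galoisStructure.{u}.galoisGroup p) ≅
            Rng.hopfQuotient f)) := by
  refine ⟨RedCRng.admissible, RedCRng.protoadditive, RedCRng.closure_inclusion, fun B P f =>
    ⟨Rng.relativeCommutator_inclusion_from_zero P, Rng.relativeCommutator_inclusion f,
      RedCRng.closure_toRng _ _, RedCRng.closure_toRng _ _,
      fun _ => Rng.mem_hopfNumerator_of_mem_kernelRadicalCommutator, fun hP hf => ?_⟩⟩
  have hu := RedCRng.isWeaklyUniversalNormalExtension_presentationExtension hP hf
  exact ⟨⟨_, _, hu⟩, fun _ _ => RedCRng.nonempty_galoisGroup_iso_hopfQuotient hu⟩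

theorem mainTheorem9 :
    -- the composite reflection is admissible and `F : CRng ⥤ RedCRng` is protoadditive
    RedCRng.galoisStructure.{u}.Admissible ∧
    Protoadditive (reflector RedCRng.inclusion.{u}) ∧
    -- the homological closure of an ideal of a commutative ring is its radical
    (∀ (A : CRng.{u}) (J : TwoSidedIdeal A.obj),
      CRng.closure RedCRng.inclusion.{u} A J = J.radical (A.commutator_mem J)) ∧
    -- free presentations `K ⟶ P ⟶ B`, with `K` the kernel of `f`
    ∀ (B P : Rng.{u}) (f : P ⟶ B), P.IsFree → IsRegularEpi f →
      -- the relative commutators `[P, P]` and `[K, P]`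
      Rng.relativeCommutator CRng.inclusion.{u} ((isZero_zero Rng.{u}).from_ P) =
        (TwoSidedIdeal.commutatorIdeal P : Set P) ∧
      Rng.relativeCommutator CRng.inclusion.{u} f =
        ((Rng.kernelIdeal f).commutatorWith : Set P) ∧
      -- their closures, in `P` and in `K` respectively, are radicals
      Rng.closure RedCRng.toRng.{u} (TwoSidedIdeal.commutatorIdeal P) = P.radicalCommutator ∧
      Rng.closure RedCRng.toRng.{u} (Rng.kernelIdeal f).commutatorIn =
        Rng.kernelRadicalCommutator f ∧
      -- `√[K, P]` is contained in `K ∧ √[P, P]`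
      (∀ k ∈ Rng.kernelRadicalCommutator f, (k : P) ∈ Rng.hopfNumerator f) ∧
      -- the fundamental group: the Galois group of any weakly universal normal extension of `B`
      (∃ (E : Rng.{u}) (p : E ⟶ B),
        RedCRng.galoisStructure.{u}.IsWeaklyUniversalNormalExtension p) ∧
      ∀ (E : Rng.{u}) (p : E ⟶ B),
        RedCRng.galoisStructure.{u}.IsWeaklyUniversalNormalExtension p →
        Nonempty (RedCRng.toRng.obj (RedCRng.galoisStructure.{u}.galoisGroup p) ≅
          Rng.hopfQuotient f) := by
  obtain ⟨hAdm, hProto, hCl, h⟩ := mainTheorem9_general.{u}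
  exact ⟨hAdm, hProto, hCl, fun B P f hP hf =>
    let ⟨h₁, h₂, h₃, h₄, h₅, hπ⟩ := h B P f; ⟨h₁, h₂, h₃, h₄, h₅, hπ hP.isRegularProjective hf⟩⟩
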